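/- Let $\Bbbk$ be a field, let $n,d\ge 1$ be integers, put $N=\{1,\dots,n\}$, and let $q\in\Bbbk^*$ be not a root of unity. Let $A=A(n,d,(q,\dots,q))$ be the $\Bbbk$-algebra generated by $x_i,y_i,h_i,h_i^{-1}$ $(i\in N)$ subject to the relations $$h_ih_i^{-1}=h_i^{-1}h_i=1,\quad x_ih_i=q\,h_ix_i,\quad y_ih_i=q^{-1}h_iy_i,\quad x_iy_i=(qh_i)^d-1,\quad y_ix_i=h_i^d-1,$$ and, for $i\neq j$, $$h_ih_j=h_jh_i,\quad h_ix_j=x_jh_i,\quad h_iy_j=y_jh_i,\quad x_ix_j=x_jx_i,\quad x_iy_j=y_jx_i,\quad y_iy_j=y_jy_i.$$ For $i\in N$ let $\sigma_i$ be the $\Bbbk$-algebra automorphism of $\Bbbk[h_1^{\pm1},\dots,h_n^{\pm1}]$ with $\sigma_i(h_i)=qh_i$ and $\sigma_i(h_j)=h_j$ for $j\ne i$. Then for every $\Bbbk$-algebra endomorphism $\psi$ of $A$ there exist a permutation $w$ of $N$, $(\tau_1,\dots,\tau_n)\in\{0,1\}^n$, $(\gamma_1,\dots,\gamma_n)\in(\Bbbk^*)^n$,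 and units $e_i,e_i'$ $(i\in N)$ of $A$, all lying (together with their inverses) in $\Bbbk[h_1^{\pm1},\dots,h_n^{\pm1}]$, such that for all $i\in N$ $$\psi(h_i)=\gamma_i h_{w(i)}^{(-1)^{\tau_i}},\qquad \psi(x_i)=e_i\,x_{w(i)}^{1-\tau_i}y_{w(i)}^{\tau_i},\qquad \psi(y_i)=x_{w(i)}^{\tau_i}y_{w(i)}^{1-\tau_i}\,e_i',$$ $$\gamma_i^d=q^{-\tau_i d},\qquad e_ie_i'=(-1)^{\tau_i}h_{w(i)}^{-d\tau_i},$$ and, for all $i\ne l$ in $N$, $$e_i\,\sigma_{w(i)}^{1-2\tau_i}(e_l)=e_l\,\sigma_{w(l)}^{1-2\tau_l}(e_i).$$ -/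

import Mathlib

namespace QWA

/-- The generators `h_i`, `h_i⁻¹`, `x_i`, `y_i` for `i ∈ {1, …, n}`. -/
inductive Gen (n : ℕ) : Type
  | h (i : Fin n) : Gen n
  | hinv (i : Fin n) : Gen n
  | x (i : Fin n) : Gen n
  | y (i : Fin n) : Gen n

/-- The defining relations of `A(n, d, (q_1, …, q_n))`, where `a_d(z) = z ^ d - 1`. -/
inductive Rel {𝕜 : Type*} [Field 𝕜] {n : ℕ} (d : ℕ) (q : Fin n → 𝕜ˣ) :
    FreeAlgebra 𝕜 (Gen n) → FreeAlgebra 𝕜 (Gen n) → Prop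
  | h_hinv (i : Fin n) :
      Rel d q (FreeAlgebra.ι 𝕜 (Gen.h i) * FreeAlgebra.ι 𝕜 (Gen.hinv i)) 1
  | hinv_h (i : Fin n) :
      Rel d q (FreeAlgebra.ι 𝕜 (Gen.hinv i) * FreeAlgebra.ι 𝕜 (Gen.h i)) 1
  | x_h (i : Fin n) :
      Rel d q (FreeAlgebra.ι 𝕜 (Gen.x i) * FreeAlgebra.ι 𝕜 (Gen.h i))
        ((q i : 𝕜) • (FreeAlgebra.ι 𝕜 (Gen.h i) * FreeAlgebra.ι 𝕜 (Gen.x i)))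
  | y_h (i : Fin n) :
      Rel d q (FreeAlgebra.ι 𝕜 (Gen.y i) * FreeAlgebra.ι 𝕜 (Gen.h i))
        (((q i)⁻¹ : 𝕜) • (FreeAlgebra.ι 𝕜 (Gen.h i) * FreeAlgebra.ι 𝕜 (Gen.y i)))
  | x_y (i : Fin n) :
      Rel d q (FreeAlgebra.ι 𝕜 (Gen.x i) * FreeAlgebra.ι 𝕜 (Gen.y i))
        (((q i : 𝕜) • FreeAlgebra.ι 𝕜 (Gen.h i)) ^ d - 1)
  | y_x (i : Fin n) :
      Rel d q (FreeAlgebra.ι 𝕜 (Gen.y i) * FreeAlgebra.ι 𝕜 (Gen.x i))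
        (FreeAlgebra.ι 𝕜 (Gen.h i) ^ d - 1)
  | hh_comm (i j : Fin n) (hij : i ≠ j) :
      Rel d q (FreeAlgebra.ι 𝕜 (Gen.h i) * FreeAlgebra.ι 𝕜 (Gen.h j))
        (FreeAlgebra.ι 𝕜 (Gen.h j) * FreeAlgebra.ι 𝕜 (Gen.h i))
  | hx_comm (i j : Fin n) (hij : i ≠ j) :
      Rel d q (FreeAlgebra.ι 𝕜 (Gen.h i) * FreeAlgebra.ι 𝕜 (Gen.x j))
        (FreeAlgebra.ι 𝕜 (Gen.x j) * FreeAlgebra.ι 𝕜 (Gen.h i))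
  | hy_comm (i j : Fin n) (hij : i ≠ j) :
      Rel d q (FreeAlgebra.ι 𝕜 (Gen.h i) * FreeAlgebra.ι 𝕜 (Gen.y j))
        (FreeAlgebra.ι 𝕜 (Gen.y j) * FreeAlgebra.ι 𝕜 (Gen.h i))
  | xx_comm (i j : Fin n) (hij : i ≠ j) :
      Rel d q (FreeAlgebra.ι 𝕜 (Gen.x i) * FreeAlgebra.ι 𝕜 (Gen.x j))
        (FreeAlgebra.ι 𝕜 (Gen.x j) * FreeAlgebra.ι 𝕜 (Gen.x i))
  | xy_comm (i j : Fin n) (hij : i ≠ j) :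
      Rel d q (FreeAlgebra.ι 𝕜 (Gen.x i) * FreeAlgebra.ι 𝕜 (Gen.y j))
        (FreeAlgebra.ι 𝕜 (Gen.y j) * FreeAlgebra.ι 𝕜 (Gen.x i))
  | yy_comm (i j : Fin n) (hij : i ≠ j) :
      Rel d q (FreeAlgebra.ι 𝕜 (Gen.y i) * FreeAlgebra.ι 𝕜 (Gen.y j))
        (FreeAlgebra.ι 𝕜 (Gen.y j) * FreeAlgebra.ι 𝕜 (Gen.y i))

/-- The quantum Weyl analogue algebra `A(n, d, (q_1, …, q_n))`, by generators and relations. -/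
abbrev A {𝕜 : Type*} [Field 𝕜] {n : ℕ} (d : ℕ) (q : Fin n → 𝕜ˣ) : Type _ :=
  RingQuot (Rel d q)

section Generators

variable {𝕜 : Type*} [Field 𝕜] {n : ℕ} (d : ℕ) (q : Fin n → 𝕜ˣ)

/-- The image in `A(n, d, q)` of a generator. -/
noncomputable def gen (g : Gen n) : A d q :=
  RingQuot.mkAlgHom 𝕜 (Rel d q) (FreeAlgebra.ι 𝕜 g)

/-- The element `x_i` of `A(n, d, q)`. -/
noncomputable def x (i : Fin n) : A d q := gen d q (Gen.x i)

/-- The element `y_i` of `A(n, d, q)`. -/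
noncomputable def y (i : Fin n) : A d q := gen d q (Gen.y i)

/-- The element `h_i` of `A(n, d, q)`, as a unit with inverse the generator `h_i⁻¹`. -/
noncomputable def h (i : Fin n) : (A d q)ˣ where
  val := gen d q (Gen.h i)
  inv := gen d q (Gen.hinv i)
  val_inv := by
    have := RingQuot.mkAlgHom_rel 𝕜 (Rel.h_hinv (d := d) (q := q) i)
    simpa [gen] using this
  inv_val := by
    have := RingQuot.mkAlgHom_rel 𝕜 (Rel.hinv_h (d := d) (q := q) i)
    simpa [gen] using this

theorem h_commute (i j : Fin n) : Commute (h d q i) (h d q j) := by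
  rcases eq_or_ne i j with rfl | hij
  · exact Commute.refl _
  · apply Units.ext
    have := RingQuot.mkAlgHom_rel 𝕜 (Rel.hh_comm (d := d) (q := q) i j hij)
    simpa [h, gen] using this

end Generators

/-- The Laurent polynomial ring `𝕜[h_1^{±1}, …, h_n^{±1}]`: the group algebra of `ℤ^n`. -/
abbrev Laurent (𝕜 : Type*) [Field 𝕜] (n : ℕ) : Type _ :=
  AddMonoidAlgebra 𝕜 (Fin n → ℤ)

section LaurentRing

variable {𝕜 : Type*} [Field 𝕜] {n : ℕ}

/-- The Laurent monomial `h_1^{m_1} ⋯ h_n^{m_n}`. -/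
noncomputable def mono (𝕜 : Type*) [Field 𝕜] {n : ℕ} (m : Fin n → ℤ) : Laurent 𝕜 n :=
  AddMonoidAlgebra.single m 1

theorem mono_add (m m' : Fin n → ℤ) : mono 𝕜 (m + m') = mono 𝕜 m * mono 𝕜 m' := by
  simp [mono, AddMonoidAlgebra.single_mul_single]

theorem mono_zero : mono 𝕜 (0 : Fin n → ℤ) = 1 := rfl

/-- The variable `h_i` of the Laurent polynomial ring, as a unit. -/
noncomputable def hL (𝕜 : Type*) [Field 𝕜] {n : ℕ} (i : Fin n) : (Laurent 𝕜 n)ˣ where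
  val := mono 𝕜 (Pi.single i 1)
  inv := mono 𝕜 (-Pi.single i 1)
  val_inv := by rw [← mono_add, add_neg_cancel, mono_zero]
  inv_val := by rw [← mono_add, neg_add_cancel, mono_zero]

/-- The `𝕜`-algebra endomorphism of the Laurent polynomial ring rescaling the variable `h_i`
by `c` and fixing the other variables. -/
noncomputable def scaleHom (c : 𝕜ˣ) (i : Fin n) : Laurent 𝕜 n →ₐ[𝕜] Laurent 𝕜 n :=
  AddMonoidAlgebra.lift 𝕜 (Laurent 𝕜 n) (Fin n → ℤ)
    { toFun := fun m => ((c ^ (m.toAdd i) : 𝕜ˣ) : 𝕜) • mono 𝕜 m.toAdd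
      map_one' := by simp [mono_zero]
      map_mul' := fun m m' => by
        simp [mono_add, zpow_add, smul_smul, mul_comm] }

theorem scaleHom_mono (c : 𝕜ˣ) (i : Fin n) (m : Fin n → ℤ) :
    scaleHom c i (mono 𝕜 m) = ((c ^ (m i) : 𝕜ˣ) : 𝕜) • mono 𝕜 m := by
  simp [scaleHom, mono]

theorem scaleHom_comp (c c' : 𝕜ˣ) (hc : c' * c = 1) (i : Fin n) :
    (scaleHom c i).comp (scaleHom c' i) = AlgHom.id 𝕜 (Laurent 𝕜 n) := by
  refine AddMonoidAlgebra.algHom_ext (fun m => ?_) (Subsingleton.elim _ _)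
  change scaleHom c i (scaleHom c' i (mono 𝕜 m)) = mono 𝕜 m
  rw [scaleHom_mono, map_smul, scaleHom_mono, smul_smul, ← Units.val_mul, ← mul_zpow, hc]
  simp

/-- The automorphism `σ_i` of `𝕜[h_1^{±1}, …, h_n^{±1}]` with `σ_i(h_i) = q_i h_i` and
`σ_i(h_j) = h_j` for `j ≠ i`. -/
noncomputable def σ (q : Fin n → 𝕜ˣ) (i : Fin n) : Laurent 𝕜 n ≃ₐ[𝕜] Laurent 𝕜 n :=
  AlgEquiv.ofAlgHom (scaleHom (q i) i) (scaleHom (q i)⁻¹ i)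
    (scaleHom_comp _ _ (by simp) i) (scaleHom_comp _ _ (by simp) i)

theorem σ_hL_self (q : Fin n → 𝕜ˣ) (i : Fin n) :
    σ q i (hL 𝕜 i : Laurent 𝕜 n) = (q i : 𝕜) • (hL 𝕜 i : Laurent 𝕜 n) := by
  change scaleHom (q i) i (mono 𝕜 (Pi.single i 1)) = _
  simp [scaleHom_mono, hL]

theorem σ_hL_of_ne (q : Fin n → 𝕜ˣ) {i j : Fin n} (hij : j ≠ i) :
    σ q i (hL 𝕜 j : Laurent 𝕜 n) = (hL 𝕜 j : Laurent 𝕜 n) := by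
  change scaleHom (q i) i (mono 𝕜 (Pi.single j 1)) = _
  simp [scaleHom_mono, hL, Pi.single_eq_of_ne hij.symm]

theorem zpowers_h_commute (d : ℕ) (q : Fin n → 𝕜ˣ) :
    Pairwise fun i j : Fin n => ∀ a b : Multiplicative ℤ,
      Commute (zpowersHom (A d q)ˣ (h d q i) a) (zpowersHom (A d q)ˣ (h d q j) b) := by
  intro i j _ a b
  simpa [zpowersHom_apply] using ((h_commute d q i j).zpow_zpow _ _)

/-- The group homomorphism `m ↦ h_1^{m_1} ⋯ h_n^{m_n}` from `ℤ^n` to the units of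
`A(n, d, q)`. -/
noncomputable def monoUnit (d : ℕ) (q : Fin n → 𝕜ˣ) :
    Multiplicative (Fin n → ℤ) →* (A d q)ˣ :=
  (MonoidHom.noncommPiCoprod (fun i : Fin n => zpowersHom (A d q)ˣ (h d q i))
    (zpowers_h_commute d q)).comp
    (MulEquiv.piMultiplicative (fun _ : Fin n => ℤ)).toMonoidHom

/-- The canonical `𝕜`-algebra homomorphism `𝕜[h_1^{±1}, …, h_n^{±1}] → A(n, d, q)`, `h_i ↦ h_i`,
by which Laurent polynomials in the `h_i` are regarded as elements of `A(n, d, q)`. -/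
noncomputable def ofLaurent (d : ℕ) (q : Fin n → 𝕜ˣ) : Laurent 𝕜 n →ₐ[𝕜] A d q :=
  AddMonoidAlgebra.lift 𝕜 (A d q) (Fin n → ℤ)
    ((Units.coeHom (A d q)).comp (monoUnit d q))

theorem ofLaurent_hL (d : ℕ) (q : Fin n → 𝕜ˣ) (i : Fin n) :
    ofLaurent d q (hL 𝕜 i : Laurent 𝕜 n) = (h d q i : A d q) := by
  have key : monoUnit d q (Multiplicative.ofAdd (Pi.single i 1)) = h d q i := by
    have h1 : MulEquiv.piMultiplicative (fun _ : Fin n => ℤ)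
        (Multiplicative.ofAdd (Pi.single i 1)) =
        Pi.mulSingle i (Multiplicative.ofAdd (1 : ℤ)) := by
      ext j
      rcases eq_or_ne j i with rfl | hj
      · simp [MulEquiv.piMultiplicative]
      · simp [MulEquiv.piMultiplicative, hj]
    rw [monoUnit, MonoidHom.comp_apply, MulEquiv.toMonoidHom_eq_coe, MonoidHom.coe_coe, h1,
      MonoidHom.noncommPiCoprod_mulSingle]
    simp [zpowersHom_apply]
  simp [ofLaurent, hL, mono, key]

end LaurentRing

end QWA

namespace QWA

/-! ### Laurent polynomials: shifts and evaluation of one variable -/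

section Laurent

variable {𝕜 : Type*} [Field 𝕜] {n : ℕ}

/-! The products `xyProd` of powers of `x_i` or `y_i` span the algebra over the Laurent polynomials.
The algebra maps to the skew Laurent ring `𝕜[h^±][t^±; σ]` by `x_i ↦ ((q h_i)^d - 1) t_i`, `y_i ↦
t_i⁻¹`, and `xyProd α` goes to a nonzero multiple of `t^α`. So the algebra is graded by `ℤ^n` with
components free of rank one (`exists_normal_form`). As `ℤ^n` has two unique sums, the factors of a
nonzero Laurent polynomial are homogeneous of opposite degrees (`homogeneous_of_mul`). If `α_j ≠ 0`,
a product of elements of degrees `-α` and `α` is divisible by `h_j^d - 1` or `(q h_j)^d - 1`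
(`mul_of_pos`, `mul_of_neg`). Hence units have degree zero and are monomials `c h^m`
(`unit_eq_smul_mono`).

Let `X, Y, H` be the images of `x_i, y_i, h_i` under an endomorphism. Then `H = c h^m`, and `Y X =
H^d - 1` is nonzero, so `X` and `Y` have degrees `α` and `-α`. The relation `X H = q H X` gives `∑
α_j m_j = 1`, because `q` is not a root of unity. Divisibility of `H^d - 1` by the factor attached
to each `j` with `α_j ≠ 0` confines `m` to that index. So `α` and `m` live on a single `j`, with
`α_j = m_j = ±1`; the sign is `τ_i`, and `j` is `w(i)` (`exists_standard_form`). Commutation of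
`x_i` with `h_l` makes `w` injective, and commutation of `x_i` with `x_l` gives the final identity.
-/

theorem laurent_induction {P : Laurent 𝕜 n → Prop} (f : Laurent 𝕜 n)
    (add : ∀ f g, P f → P g → P (f + g)) (smul : ∀ (c : 𝕜) f, P f → P (c • f))
    (one : P 1) (mul : ∀ f g, P f → P g → P (f * g))
    (var : ∀ i : Fin n, P (hL 𝕜 i : Laurent 𝕜 n))
    (inv : ∀ i : Fin n, P ((hL 𝕜 i)⁻¹ : (Laurent 𝕜 n)ˣ)) : P f := by
  classical
  have key : ∀ m : Fin n → ℤ, P (mono 𝕜 m) := by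
    intro m
    have single : ∀ (i : Fin n) (k : ℤ), P (mono 𝕜 (Pi.single i k)) := by
      intro i k
      induction k using Int.induction_on with
      | zero => rw [Pi.single_zero]; exact one
      | succ k ih =>
        rw [Pi.single_add, mono_add]
        exact mul _ _ ih (var i)
      | pred k ih =>
        rw [sub_eq_add_neg, Pi.single_add, mono_add]
        refine mul _ _ ih ?_
        rw [Pi.single_neg]
        exact inv i
    rw [← Finset.univ_sum_single m]
    induction (Finset.univ : Finset (Fin n)) using Finset.induction_on with
    | empty => exact one
    | insert i s hi ih =>
      rw [Finset.sum_insert hi, mono_add]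
      exact mul _ _ (single i _) ih
  refine AddMonoidAlgebra.induction_on f (fun m => key m) add smul

theorem laurent_ext {B : Type*} [Semiring B] [Algebra 𝕜 B] {F G : Laurent 𝕜 n →ₐ[𝕜] B}
    (hFG : ∀ i : Fin n, F (hL 𝕜 i : Laurent 𝕜 n) = G (hL 𝕜 i : Laurent 𝕜 n)) : F = G := by
  refine AlgHom.ext fun f => ?_
  refine laurent_induction (P := fun f => F f = G f) f ?_ ?_ ?_ ?_ hFG ?_
  · intro f g hf hg; simp only [map_add, hf, hg]
  · intro c f hf; simp only [map_smul, hf]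
  · simp
  · intro f g hf hg; simp only [map_mul, hf, hg]
  · intro i
    have h1 : (Units.map (F : Laurent 𝕜 n →* B) (hL 𝕜 i)) =
      Units.map (G : Laurent 𝕜 n →* B) (hL 𝕜 i) := Units.ext (hFG i)
    have h2 := congrArg (fun u : Bˣ => ((u⁻¹ : Bˣ) : B)) h1
    exact h2

theorem laurent_eq_single {f : Laurent 𝕜 n} {c : 𝕜} {m : Fin n → ℤ}
    (h : f = AddMonoidAlgebra.single m c) : f = c • mono 𝕜 m := by
  rw [h, mono, AddMonoidAlgebra.smul_single, smul_eq_mul, mul_one]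

/-- The pairing `(α, m) ↦ ∏ q_i ^ (α_i m_i)`, with values in `𝕜ˣ`. -/
def chi (q : Fin n → 𝕜ˣ) (α m : Fin n → ℤ) : 𝕜ˣ := ∏ i, q i ^ (α i * m i)

theorem chi_add_left (q : Fin n → 𝕜ˣ) (α β m : Fin n → ℤ) :
    chi q (α + β) m = chi q α m * chi q β m := by
  simp [chi, add_mul, zpow_add, Finset.prod_mul_distrib]

theorem chi_add_right (q : Fin n → 𝕜ˣ) (α m m' : Fin n → ℤ) :
    chi q α (m + m') = chi q α m * chi q α m' := by
  simp [chi, mul_add, zpow_add, Finset.prod_mul_distrib]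

theorem chi_single_left (q : Fin n → 𝕜ˣ) (i : Fin n) (k : ℤ) (m : Fin n → ℤ) :
    chi q (Pi.single i k) m = q i ^ (k * m i) := by
  rw [chi, Finset.prod_eq_single i]
  · simp
  · intro j _ hj; simp [hj]
  · simp

/-- The automorphism `σ_1 ^ α_1 ⋯ σ_n ^ α_n` of the Laurent polynomial ring. -/
noncomputable def shift (q : Fin n → 𝕜ˣ) (α : Fin n → ℤ) : Laurent 𝕜 n →ₐ[𝕜] Laurent 𝕜 n :=
  AddMonoidAlgebra.lift 𝕜 (Laurent 𝕜 n) (Fin n → ℤ)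
    { toFun := fun m => (chi q α m.toAdd : 𝕜) • mono 𝕜 m.toAdd
      map_one' := by simp [mono_zero, chi]
      map_mul' := fun m m' => by
        simp [mono_add, chi_add_right, smul_smul, mul_comm] }

theorem shift_mono (q : Fin n → 𝕜ˣ) (α m : Fin n → ℤ) :
    shift q α (mono 𝕜 m) = (chi q α m : 𝕜) • mono 𝕜 m := by
  simp [shift, mono]

theorem shift_add (q : Fin n → 𝕜ˣ) (α β : Fin n → ℤ) (f : Laurent 𝕜 n) :
    shift q (α + β) f = shift q α (shift q β f) := by
  have : shift q (α + β) = (shift q α).comp (shift q β) := by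
    refine AddMonoidAlgebra.algHom_ext (fun m => ?_) (Subsingleton.elim _ _)
    change shift q (α + β) (mono 𝕜 m) = shift q α (shift q β (mono 𝕜 m))
    rw [shift_mono, shift_mono, map_smul, shift_mono, smul_smul, chi_add_left, Units.val_mul,
      mul_comm]
  rw [this]; rfl

theorem shift_zero (q : Fin n → 𝕜ˣ) (f : Laurent 𝕜 n) : shift q 0 f = f := by
  have : shift q (0 : Fin n → ℤ) = AlgHom.id 𝕜 (Laurent 𝕜 n) := by
    refine AddMonoidAlgebra.algHom_ext (fun m => ?_) (Subsingleton.elim _ _)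
    change shift q 0 (mono 𝕜 m) = mono 𝕜 m
    rw [shift_mono]
    simp [chi]
  rw [this]; rfl

theorem shift_neg_shift (q : Fin n → 𝕜ˣ) (α : Fin n → ℤ) (f : Laurent 𝕜 n) :
    shift q (-α) (shift q α f) = f := by
  rw [← shift_add, neg_add_cancel, shift_zero]

theorem shift_shift_neg (q : Fin n → 𝕜ˣ) (α : Fin n → ℤ) (f : Laurent 𝕜 n) :
    shift q α (shift q (-α) f) = f := by
  rw [← shift_add, add_neg_cancel, shift_zero]

theorem shift_ne_zero (q : Fin n → 𝕜ˣ) (α : Fin n → ℤ) {f : Laurent 𝕜 n} (hf : f ≠ 0) :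
    shift q α f ≠ 0 := by
  intro h0
  apply hf
  rw [← shift_neg_shift q α f, h0, map_zero]

theorem shift_single_hL_self (q : Fin n → 𝕜ˣ) (i : Fin n) (k : ℤ) :
    shift q (Pi.single i k) (hL 𝕜 i : Laurent 𝕜 n) =
      ((q i ^ k : 𝕜ˣ) : 𝕜) • (hL 𝕜 i : Laurent 𝕜 n) := by
  change shift q _ (mono 𝕜 _) = _
  rw [shift_mono, chi_single_left]
  simp [hL]

theorem shift_single_hL_of_ne (q : Fin n → 𝕜ˣ) {i j : Fin n} (hij : j ≠ i) (k : ℤ) :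
    shift q (Pi.single i k) (hL 𝕜 j : Laurent 𝕜 n) = (hL 𝕜 j : Laurent 𝕜 n) := by
  change shift q _ (mono 𝕜 _) = _
  rw [shift_mono, chi_single_left]
  simp [hL, hij.symm]

theorem σ_apply (q : Fin n → 𝕜ˣ) (i : Fin n) (f : Laurent 𝕜 n) :
    σ q i f = shift q (Pi.single i 1) f := by
  have : (σ q i : Laurent 𝕜 n →ₐ[𝕜] Laurent 𝕜 n) = shift q (Pi.single i 1) := by
    refine laurent_ext fun j => ?_
    rcases eq_or_ne j i with rfl | hj
    · rw [shift_single_hL_self]; simpa using σ_hL_self q j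
    · rw [shift_single_hL_of_ne q hj]; simpa using σ_hL_of_ne q hj
  exact DFunLike.congr_fun this f

theorem σ_symm_apply (q : Fin n → 𝕜ˣ) (i : Fin n) (f : Laurent 𝕜 n) :
    (σ q i).symm f = shift q (Pi.single i (-1)) f := by
  rw [AlgEquiv.symm_apply_eq, σ_apply, Pi.single_neg, shift_shift_neg]

/-- Evaluation of the variable `h_j` at `s`, keeping the other variables. -/
noncomputable def evalAt (s : 𝕜ˣ) (j : Fin n) : Laurent 𝕜 n →ₐ[𝕜] Laurent 𝕜 n :=
  AddMonoidAlgebra.lift 𝕜 (Laurent 𝕜 n) (Fin n → ℤ)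
    { toFun := fun m => ((s ^ m.toAdd j : 𝕜ˣ) : 𝕜) • mono 𝕜 (m.toAdd - Pi.single j (m.toAdd j))
      map_one' := by simp [mono_zero]
      map_mul' := fun m m' => by
        rw [smul_mul_smul_comm, ← mono_add, ← Units.val_mul, ← zpow_add]
        simp only [toAdd_mul, Pi.add_apply, Pi.single_add]
        congr 2
        abel }

theorem evalAt_mono (s : 𝕜ˣ) (j : Fin n) (m : Fin n → ℤ) :
    evalAt s j (mono 𝕜 m) = ((s ^ m j : 𝕜ˣ) : 𝕜) • mono 𝕜 (m - Pi.single j (m j)) := by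
  simp [evalAt, mono]

theorem evalAt_hL_self (s : 𝕜ˣ) (j : Fin n) :
    evalAt s j (hL 𝕜 j : Laurent 𝕜 n) = algebraMap 𝕜 _ (s : 𝕜) := by
  change evalAt s j (mono 𝕜 _) = _
  rw [evalAt_mono]
  simp [mono_zero, Algebra.algebraMap_eq_smul_one]

theorem mono_pow (m : Fin n → ℤ) (d : ℕ) : mono 𝕜 m ^ d = mono 𝕜 (d • m) := by
  simp [mono, AddMonoidAlgebra.single_pow]

theorem eq_zero_of_smul_mono_eq_one {c : 𝕜} {m : Fin n → ℤ} (h : c • mono 𝕜 m = 1) :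
    m = 0 ∧ c = 1 := by
  rw [mono, AddMonoidAlgebra.smul_single, smul_eq_mul, mul_one, AddMonoidAlgebra.one_def,
    AddMonoidAlgebra.single_inj] at h
  rcases h with h | h
  · exact h
  · exact absurd h.2 one_ne_zero

/-- If `h_j - s` divides `c h^{d m} - 1` then only `h_j` occurs in `h^m`, and `c s^{d m_j} = 1`. -/
theorem exponent_of_dvd {s c : 𝕜ˣ} {d : ℕ} (hd : 0 < d) {j : Fin n} {m : Fin n → ℤ}
    {f g : Laurent 𝕜 n} (hfg : ((c : 𝕜) • mono 𝕜 m) ^ d - 1 = f * g) (hg : evalAt s j g = 0) :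
    m = Pi.single j (m j) ∧ (c * s ^ m j) ^ d = 1 := by
  -- At `h_j = s` the right side vanishes, leaving a scalar multiple of a monomial equal to `1`;
  -- exponent and scalar can then be compared.
  have h := congrArg (evalAt s j) hfg
  rw [map_mul, hg, mul_zero, map_sub, map_one, map_pow, map_smul, evalAt_mono, smul_smul,
    smul_pow, mono_pow, sub_eq_zero] at h
  obtain ⟨h1, h2⟩ := eq_zero_of_smul_mono_eq_one h
  refine ⟨sub_eq_zero.mp ((smul_eq_zero.mp h1).resolve_left hd.ne'), ?_⟩
  rw [Units.ext_iff]
  simpa using h2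

end Laurent

/-! ### Factors of homogeneous elements in a group algebra -/

section UniqueSums

/-- If a product of two elements of a graded group algebra is homogeneous and nonzero, and no two
coefficients annihilate each other, both factors are homogeneous. -/
theorem eq_single_of_mul_eq_single {R G : Type*} [Semiring R] [AddMonoid G] [TwoUniqueSums G]
    {f g : AddMonoidAlgebra R G} {c : G} {r : R} (hfg : f * g = AddMonoidAlgebra.single c r)
    (hne : ∀ a b, f.coeff a ≠ 0 → g.coeff b ≠ 0 → f.coeff a * g.coeff b ≠ 0)
    (hf : f ≠ 0) (hg : g ≠ 0) :
    ∃ a b, a + b = c ∧ f = AddMonoidAlgebra.single a (f.coeff a) ∧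
      g = AddMonoidAlgebra.single b (g.coeff b) := by
  classical
  have hf' : f.coeff.support.Nonempty := by
    rw [Finsupp.support_nonempty_iff]; simpa using hf
  have hg' : g.coeff.support.Nonempty := by
    rw [Finsupp.support_nonempty_iff]; simpa using hg
  -- At a uniquely represented sum the coefficient of the product is a single nonzero product, so
  -- that sum must be `c`.
  have hc : ∀ a ∈ f.coeff.support, ∀ b ∈ g.coeff.support,
      UniqueAdd f.coeff.support g.coeff.support a b → a + b = c := by
    intro a ha b hb hu
    have h1 := AddMonoidAlgebra.coeff_mul_add_of_uniqueAdd hu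
    by_contra hcon
    rw [hfg, AddMonoidAlgebra.coeff_single, Finsupp.single_eq_of_ne hcon] at h1
    exact hne a b (Finsupp.mem_support_iff.mp ha) (Finsupp.mem_support_iff.mp hb) h1.symm
  -- Otherwise two different pairs have uniquely represented sums; both sums are `c`, which
  -- contradicts uniqueness.
  have hcard : f.coeff.support.card * g.coeff.support.card ≤ 1 := by
    by_contra hcon
    obtain ⟨p, hp, p', hp', hpp, hu, hu'⟩ :=
      TwoUniqueSums.uniqueAdd_of_one_lt_card (not_le.mp hcon)
    rw [Finset.mem_product] at hp hp'
    have h1 := hc _ hp.1 _ hp.2 hu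
    have h2 := hc _ hp'.1 _ hp'.2 hu'
    have h3 := hu hp'.1 hp'.2 (h2.trans h1.symm)
    exact hpp (Prod.ext h3.1.symm h3.2.symm)
  have h1 : f.coeff.support.card = 1 := by
    have := hf'.card_pos; have := hg'.card_pos; nlinarith
  have h2 : g.coeff.support.card = 1 := by
    have := hf'.card_pos; have := hg'.card_pos; nlinarith
  obtain ⟨a, ha⟩ := Finset.card_eq_one.mp h1
  obtain ⟨b, hb⟩ := Finset.card_eq_one.mp h2
  refine ⟨a, b, hc a (by simp [ha]) b (by simp [hb]) ?_, ?_, ?_⟩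
  · rw [ha, hb]
    intro a' b' ha' hb' _
    simp_all
  · rw [← AddMonoidAlgebra.coeff_inj, AddMonoidAlgebra.coeff_single]
    exact (Finsupp.support_subset_singleton.mp ha.subset)
  · rw [← AddMonoidAlgebra.coeff_inj, AddMonoidAlgebra.coeff_single]
    exact (Finsupp.support_subset_singleton.mp hb.subset)

theorem laurent_unit {𝕜 : Type*} [Field 𝕜] {n : ℕ} {f g : Laurent 𝕜 n} (hfg : f * g = 1) :
    ∃ (c : 𝕜ˣ) (m : Fin n → ℤ), f = (c : 𝕜) • mono 𝕜 m := by
  have hf : f ≠ 0 := left_ne_zero_of_mul_eq_one hfg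
  have hg : g ≠ 0 := right_ne_zero_of_mul_eq_one hfg
  obtain ⟨a, b, -, hfa, -⟩ := eq_single_of_mul_eq_single
    (hfg.trans AddMonoidAlgebra.one_def) (fun a b => mul_ne_zero) hf hg
  have h0 : f.coeff a ≠ 0 := by
    intro h0
    rw [h0, AddMonoidAlgebra.single_zero] at hfa
    exact hf hfa
  exact ⟨Units.mk0 _ h0, a, laurent_eq_single hfa⟩

end UniqueSums

end QWA

namespace QWA

/-! ### The graded representation in the skew Laurent ring -/

section Representation

variable {𝕜 : Type*} [Field 𝕜] {n : ℕ} (d : ℕ) (q : Fin n → 𝕜ˣ)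

/-- The operator `f σ^α` on the Laurent polynomial ring. -/
noncomputable def skewEnd (f : Laurent 𝕜 n) (α : Fin n → ℤ) : Module.End 𝕜 (Laurent 𝕜 n) :=
  LinearMap.mulLeft 𝕜 f * (shift q α).toLinearMap

theorem skewEnd_apply (f g : Laurent 𝕜 n) (α : Fin n → ℤ) :
    skewEnd q f α g = f * shift q α g := rfl

theorem skewEnd_injective (α : Fin n → ℤ) : Function.Injective fun f => skewEnd q f α := by
  intro f g hfg
  simpa [skewEnd_apply] using DFunLike.congr_fun hfg 1

theorem skewEnd_mul (f g : Laurent 𝕜 n) (α β : Fin n → ℤ) :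
    skewEnd q f α * skewEnd q g β = skewEnd q (f * shift q α g) (α + β) := by
  refine LinearMap.ext fun u => ?_
  simp [skewEnd_apply, shift_add, mul_assoc]

/-- The element `f t^α` of the skew Laurent ring `𝕜[h^±][t^±; σ]`, realised as a graded operator. -/
noncomputable def skew (f : Laurent 𝕜 n) (α : Fin n → ℤ) :
    AddMonoidAlgebra (Module.End 𝕜 (Laurent 𝕜 n)) (Fin n → ℤ) :=
  AddMonoidAlgebra.single α (skewEnd q f α)

/-- The twist is carried by composition of operators, so an untwisted group algebra suffices; its
grading keeps different degrees independent. -/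
theorem skew_mul (f g : Laurent 𝕜 n) (α β : Fin n → ℤ) :
    skew q f α * skew q g β = skew q (f * shift q α g) (α + β) := by
  rw [skew, skew, AddMonoidAlgebra.single_mul_single, skewEnd_mul, skew]

theorem skew_add (f g : Laurent 𝕜 n) (α : Fin n → ℤ) :
    skew q (f + g) α = skew q f α + skew q g α := by
  have : skewEnd q (f + g) α = skewEnd q f α + skewEnd q g α := by
    refine LinearMap.ext fun u => ?_
    simp [skewEnd_apply, add_mul]
  rw [skew, this, AddMonoidAlgebra.single_add, skew, skew]

theorem smul_skew (c : 𝕜) (f : Laurent 𝕜 n) (α : Fin n → ℤ) :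
    c • skew q f α = skew q (c • f) α := by
  have : skewEnd q (c • f) α = c • skewEnd q f α := by
    refine LinearMap.ext fun u => ?_
    simp [skewEnd_apply]
  rw [skew, skew, this, AddMonoidAlgebra.smul_single]

theorem skew_one : skew q (1 : Laurent 𝕜 n) 0 = 1 := by
  have : skewEnd q (1 : Laurent 𝕜 n) 0 = 1 :=
    LinearMap.ext fun u => by simp [skewEnd_apply, shift_zero]
  rw [skew, this, AddMonoidAlgebra.one_def]

theorem skew_inj {f g : Laurent 𝕜 n} {α : Fin n → ℤ} : skew q f α = skew q g α ↔ f = g :=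
  ⟨fun h => skewEnd_injective q α (AddMonoidAlgebra.single_right_injective h), fun h => by rw [h]⟩

/-- The degree zero part of the skew Laurent ring. -/
noncomputable def skewZero :
    Laurent 𝕜 n →ₐ[𝕜] AddMonoidAlgebra (Module.End 𝕜 (Laurent 𝕜 n)) (Fin n → ℤ) :=
  AlgHom.ofLinearMap
    { toFun := fun f => skew q f 0
      map_add' := fun f g => skew_add q f g 0
      map_smul' := fun c f => (smul_skew q c f 0).symm }
    (skew_one q) (fun f g => by
      change skew q (f * g) 0 = skew q f 0 * skew q g 0
      rw [skew_mul, shift_zero, add_zero])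

theorem skewZero_apply (f : Laurent 𝕜 n) : skewZero q f = skew q f 0 := rfl

/-- The images of the generators in the skew Laurent ring. -/
noncomputable def genImage :
    Gen n → AddMonoidAlgebra (Module.End 𝕜 (Laurent 𝕜 n)) (Fin n → ℤ)
  | Gen.h i => skew q (hL 𝕜 i : Laurent 𝕜 n) 0
  | Gen.hinv i => skew q ((hL 𝕜 i)⁻¹ : (Laurent 𝕜 n)ˣ) 0
  | Gen.x i => skew q (((q i : 𝕜) • (hL 𝕜 i : Laurent 𝕜 n)) ^ d - 1) (Pi.single i 1)
  | Gen.y i => skew q 1 (Pi.single i (-1))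

theorem genImage_rel ⦃a b : FreeAlgebra 𝕜 (Gen n)⦄ (hab : Rel d q a b) :
    FreeAlgebra.lift 𝕜 (genImage d q) a = FreeAlgebra.lift 𝕜 (genImage d q) b := by
  have hadd : ∀ i : Fin n, (Pi.single i 1 + Pi.single i (-1) : Fin n → ℤ) = 0 := fun i => by
    rw [← Pi.single_add]; simp
  have hadd' : ∀ i : Fin n, (Pi.single i (-1) + Pi.single i 1 : Fin n → ℤ) = 0 := fun i => by
    rw [← Pi.single_add]; simp
  induction hab with
  | h_hinv i => simp [genImage, skew_mul, shift_zero, skew_one]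
  | hinv_h i => simp [genImage, skew_mul, shift_zero, skew_one]
  | x_h i =>
    simp [genImage, skew_mul, shift_zero, smul_skew, shift_single_hL_self, mul_comm]
  | y_h i =>
    simp [genImage, skew_mul, shift_zero, smul_skew, shift_single_hL_self, mul_comm]
  | x_y i =>
    simp only [map_mul, map_sub, map_pow, map_smul, map_one, FreeAlgebra.lift_ι_apply, genImage]
    rw [skew_mul, hadd, map_one, mul_one, ← skewZero_apply, ← skewZero_apply]
    simp
  | y_x i =>
    simp only [map_mul, map_sub, map_pow, map_one, FreeAlgebra.lift_ι_apply, genImage]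
    -- Moving `t_i⁻¹` past the coefficient of `x_i` turns `q h_i` into `h_i`.
    rw [skew_mul, hadd', one_mul, map_sub, map_pow, map_smul, shift_single_hL_self,
      ← skewZero_apply, ← skewZero_apply]
    simp
  | hh_comm i j hij => simp [genImage, skew_mul, shift_zero, mul_comm]
  | hx_comm i j hij =>
    simp [genImage, skew_mul, shift_zero, shift_single_hL_of_ne q hij, mul_comm]
  | hy_comm i j hij =>
    simp [genImage, skew_mul, shift_zero, shift_single_hL_of_ne q hij, mul_comm]
  | xx_comm i j hij =>
    simp [genImage, skew_mul, shift_single_hL_of_ne q hij, shift_single_hL_of_ne q hij.symm,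
      mul_comm, add_comm]
  | xy_comm i j hij =>
    simp [genImage, skew_mul, shift_single_hL_of_ne q hij, add_comm]
  | yy_comm i j hij => simp [genImage, skew_mul, add_comm]

/-- The homomorphism from `A(n, d, q)` to the skew Laurent ring. -/
noncomputable def toSkew :
    A d q →ₐ[𝕜] AddMonoidAlgebra (Module.End 𝕜 (Laurent 𝕜 n)) (Fin n → ℤ) :=
  RingQuot.liftAlgHom 𝕜 ⟨FreeAlgebra.lift 𝕜 (genImage d q), genImage_rel d q⟩

theorem toSkew_gen (g : Gen n) : toSkew d q (gen d q g) = genImage d q g := by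
  rw [toSkew, gen, RingQuot.liftAlgHom_mkAlgHom_apply, FreeAlgebra.lift_ι_apply]

theorem toSkew_x (i : Fin n) : toSkew d q (x d q i) =
    skew q (((q i : 𝕜) • (hL 𝕜 i : Laurent 𝕜 n)) ^ d - 1) (Pi.single i 1) :=
  toSkew_gen d q (Gen.x i)

theorem toSkew_y (i : Fin n) : toSkew d q (y d q i) = skew q 1 (Pi.single i (-1)) :=
  toSkew_gen d q (Gen.y i)

theorem toSkew_ofLaurent (f : Laurent 𝕜 n) : toSkew d q (ofLaurent d q f) = skew q f 0 := by
  have : (toSkew d q).comp (ofLaurent d q) = skewZero q := by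
    refine laurent_ext fun i => ?_
    rw [AlgHom.comp_apply, ofLaurent_hL]
    exact toSkew_gen d q (Gen.h i)
  exact DFunLike.congr_fun this f

theorem ofLaurent_injective : Function.Injective (ofLaurent d q) := by
  intro f g hfg
  have := congrArg (toSkew d q) hfg
  rwa [toSkew_ofLaurent, toSkew_ofLaurent, skew_inj] at this

end Representation

/-! ### Commutation rules in the algebra -/

section Relations

variable {𝕜 : Type*} [Field 𝕜] {n : ℕ} (d : ℕ) (q : Fin n → 𝕜ˣ)

theorem gen_induction {P : A d q → Prop} (a : A d q)
    (scalar : ∀ c : 𝕜, P (algebraMap 𝕜 _ c)) (add : ∀ a b, P a → P b → P (a + b))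
    (mul : ∀ a b, P a → P b → P (a * b)) (gens : ∀ g, P (gen d q g)) : P a := by
  obtain ⟨a, rfl⟩ := RingQuot.mkAlgHom_surjective 𝕜 (Rel d q) a
  induction a using FreeAlgebra.induction with
  | grade0 c => rw [AlgHom.commutes]; exact scalar c
  | grade1 g => exact gens g
  | mul a b ha hb => rw [map_mul]; exact mul _ _ ha hb
  | add a b ha hb => rw [map_add]; exact add _ _ ha hb

theorem x_mul_h (i : Fin n) : x d q i * h d q i = (q i : 𝕜) • ((h d q i : A d q) * x d q i) := by
  simpa [x, h, gen] using RingQuot.mkAlgHom_rel 𝕜 (Rel.x_h (d := d) (q := q) i)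

theorem y_mul_h (i : Fin n) :
    y d q i * h d q i = ((q i)⁻¹ : 𝕜) • ((h d q i : A d q) * y d q i) := by
  simpa [y, h, gen] using RingQuot.mkAlgHom_rel 𝕜 (Rel.y_h (d := d) (q := q) i)

theorem x_mul_y (i : Fin n) : x d q i * y d q i =
    ofLaurent d q (((q i : 𝕜) • (hL 𝕜 i : Laurent 𝕜 n)) ^ d - 1) := by
  rw [map_sub, map_pow, map_smul, ofLaurent_hL, map_one]
  simpa [x, y, h, gen] using RingQuot.mkAlgHom_rel 𝕜 (Rel.x_y (d := d) (q := q) i)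

theorem y_mul_x (i : Fin n) : y d q i * x d q i =
    ofLaurent d q ((hL 𝕜 i : Laurent 𝕜 n) ^ d - 1) := by
  rw [map_sub, map_pow, ofLaurent_hL, map_one]
  simpa [x, y, h, gen] using RingQuot.mkAlgHom_rel 𝕜 (Rel.y_x (d := d) (q := q) i)

theorem commute_h_x {i j : Fin n} (hij : i ≠ j) : Commute (h d q i : A d q) (x d q j) := by
  change _ * _ = _ * _
  simpa [x, y, h, gen] using RingQuot.mkAlgHom_rel 𝕜 (Rel.hx_comm (d := d) (q := q) i j hij)

theorem commute_h_y {i j : Fin n} (hij : i ≠ j) : Commute (h d q i : A d q) (y d q j) := by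
  change _ * _ = _ * _
  simpa [x, y, h, gen] using RingQuot.mkAlgHom_rel 𝕜 (Rel.hy_comm (d := d) (q := q) i j hij)

theorem commute_x_x {i j : Fin n} (hij : i ≠ j) : Commute (x d q i) (x d q j) := by
  change _ * _ = _ * _
  simpa [x, y, h, gen] using RingQuot.mkAlgHom_rel 𝕜 (Rel.xx_comm (d := d) (q := q) i j hij)

theorem commute_x_y {i j : Fin n} (hij : i ≠ j) : Commute (x d q i) (y d q j) := by
  change _ * _ = _ * _
  simpa [x, y, h, gen] using RingQuot.mkAlgHom_rel 𝕜 (Rel.xy_comm (d := d) (q := q) i j hij)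

theorem commute_y_y {i j : Fin n} (hij : i ≠ j) : Commute (y d q i) (y d q j) := by
  change _ * _ = _ * _
  simpa [x, y, h, gen] using RingQuot.mkAlgHom_rel 𝕜 (Rel.yy_comm (d := d) (q := q) i j hij)

theorem mul_ofLaurent_of_hL {α : Fin n → ℤ} {a : A d q}
    (ha : ∀ i : Fin n, a * h d q i =
      ofLaurent d q (shift q α (hL 𝕜 i : Laurent 𝕜 n)) * a) (f : Laurent 𝕜 n) :
    a * ofLaurent d q f = ofLaurent d q (shift q α f) * a := by
  refine laurent_induction
    (P := fun f => a * ofLaurent d q f = ofLaurent d q (shift q α f) * a) f ?_ ?_ ?_ ?_ ?_ ?_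
  · intro f g hf hg; simp only [map_add, mul_add, add_mul, hf, hg]
  · intro c f hf; simp only [map_smul, mul_smul_comm, smul_mul_assoc, hf]
  · simp
  · intro f g hf hg
    rw [map_mul, ← mul_assoc, hf, mul_assoc, hg, map_mul, map_mul, mul_assoc]
  · intro i; rw [ofLaurent_hL, ha]
  · intro i
    have h1 := ha i
    rw [← ofLaurent_hL] at h1
    have h2 : ofLaurent d q (hL 𝕜 i : Laurent 𝕜 n) *
        ofLaurent d q ((hL 𝕜 i)⁻¹ : (Laurent 𝕜 n)ˣ) = 1 := by
      rw [← map_mul, Units.mul_inv, map_one]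
    have h3 : ofLaurent d q (shift q α ((hL 𝕜 i)⁻¹ : (Laurent 𝕜 n)ˣ)) *
        ofLaurent d q (shift q α (hL 𝕜 i : Laurent 𝕜 n)) = 1 := by
      rw [← map_mul, ← map_mul, Units.inv_mul, map_one, map_one]
    generalize ofLaurent d q ((hL 𝕜 i)⁻¹ : (Laurent 𝕜 n)ˣ) = u at *
    generalize ofLaurent d q (shift q α ((hL 𝕜 i)⁻¹ : (Laurent 𝕜 n)ˣ)) = v at *
    -- The rule for `h_i`, multiplied by `v` on the left and `u` on the right, becomes the rule for
    -- its inverse.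
    calc a * u = v * (ofLaurent d q (shift q α (hL 𝕜 i : Laurent 𝕜 n)) * a) * u := by
          rw [← mul_assoc v, h3, one_mul]
      _ = v * a := by rw [← h1, mul_assoc, mul_assoc, h2, mul_one]

theorem x_mul_ofLaurent (i : Fin n) (f : Laurent 𝕜 n) :
    x d q i * ofLaurent d q f = ofLaurent d q (shift q (Pi.single i 1) f) * x d q i := by
  refine mul_ofLaurent_of_hL d q (fun j => ?_) f
  rcases eq_or_ne j i with rfl | hj
  · rw [x_mul_h, shift_single_hL_self, map_smul, ofLaurent_hL, smul_mul_assoc, zpow_one]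
  · rw [shift_single_hL_of_ne q hj, ofLaurent_hL]
    exact (commute_h_x d q hj).symm.eq

theorem y_mul_ofLaurent (i : Fin n) (f : Laurent 𝕜 n) :
    y d q i * ofLaurent d q f = ofLaurent d q (shift q (Pi.single i (-1)) f) * y d q i := by
  refine mul_ofLaurent_of_hL d q (fun j => ?_) f
  rcases eq_or_ne j i with rfl | hj
  · rw [y_mul_h, shift_single_hL_self, map_smul, ofLaurent_hL, smul_mul_assoc]
    simp
  · rw [shift_single_hL_of_ne q hj, ofLaurent_hL]
    exact (commute_h_y d q hj).symm.eq

end Relations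

end QWA

namespace QWA

/-! ### The spanning products of powers of `x_i` and `y_i` -/

section Basis

variable {𝕜 : Type*} [Field 𝕜] {n : ℕ} (d : ℕ) (q : Fin n → 𝕜ˣ)

/-- `x_i ^ k` for `k ≥ 0` and `y_i ^ (-k)` for `k < 0`. -/
noncomputable def xy (i : Fin n) : ℤ → A d q
  | Int.ofNat k => x d q i ^ k
  | Int.negSucc k => y d q i ^ (k + 1)

theorem xy_zero (i : Fin n) : xy d q i 0 = 1 := pow_zero _

theorem xy_one (i : Fin n) : xy d q i 1 = x d q i := pow_one _

theorem xy_neg_one (i : Fin n) : xy d q i (-1) = y d q i := pow_one _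

theorem xy_of_pos (i : Fin n) {k : ℤ} (hk : 0 < k) : xy d q i k = x d q i * xy d q i (k - 1) := by
  obtain ⟨m, rfl⟩ : ∃ m : ℕ, k = m + 1 := ⟨(k - 1).toNat, by omega⟩
  rw [add_sub_cancel_right]
  exact pow_succ' _ _

theorem xy_of_neg (i : Fin n) {k : ℤ} (hk : k < 0) : xy d q i k = y d q i * xy d q i (k + 1) := by
  obtain ⟨m, rfl⟩ : ∃ m : ℕ, k = Int.negSucc m := ⟨(-k - 1).toNat, by omega⟩
  rcases m with _ | m
  · change y d q i ^ (0 + 1) = y d q i * xy d q i 0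
    rw [xy_zero, mul_one, zero_add, pow_one]
  · exact pow_succ' _ _

theorem x_mul_xy (i : Fin n) (k : ℤ) :
    ∃ g, x d q i * xy d q i k = ofLaurent d q g * xy d q i (k + 1) := by
  rcases lt_or_ge k 0 with hk | hk
  · exact ⟨_, by rw [xy_of_neg d q i hk, ← mul_assoc, x_mul_y]⟩
  · exact ⟨1, by rw [map_one, one_mul, xy_of_pos d q i (show 0 < k + 1 by omega),
      add_sub_cancel_right]⟩

theorem y_mul_xy (i : Fin n) (k : ℤ) :
    ∃ g, y d q i * xy d q i k = ofLaurent d q g * xy d q i (k - 1) := by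
  rcases lt_or_ge 0 k with hk | hk
  · exact ⟨_, by rw [xy_of_pos d q i hk, ← mul_assoc, y_mul_x]⟩
  · exact ⟨1, by rw [map_one, one_mul, xy_of_neg d q i (show k - 1 < 0 by omega),
      sub_add_cancel]⟩

theorem commute_xy {i j : Fin n} (hij : i ≠ j) (k l : ℤ) :
    Commute (xy d q i k) (xy d q j l) := by
  rcases k with k | k <;> rcases l with l | l
  · exact (commute_x_x d q hij).pow_pow _ _
  · exact (commute_x_y d q hij).pow_pow _ _
  · exact (commute_x_y d q hij.symm).symm.pow_pow _ _
  · exact (commute_y_y d q hij).pow_pow _ _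

theorem commute_xy_self (i : Fin n) {k : ℤ} : (0 ≤ k → Commute (x d q i) (xy d q i k)) ∧
    (k ≤ 0 → Commute (y d q i) (xy d q i k)) := by
  rcases k with k | k
  · refine ⟨fun _ => (Commute.refl _).pow_right _, fun hk => ?_⟩
    obtain rfl : k = 0 := by simpa using hk
    change Commute (y d q i) (x d q i ^ 0)
    rw [pow_zero]
    exact Commute.one_right _
  · exact ⟨fun hk => absurd hk (by simp), fun _ => (Commute.refl _).pow_right _⟩

theorem pairwise_commute_xy (α : Fin n → ℤ) (s : Set (Fin n)) :
    s.Pairwise (Function.onFun Commute fun i => xy d q i (α i)) :=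
  fun _ _ _ _ hij => commute_xy d q hij _ _

/-- The basis element of degree `α` of `A(n, d, q)` over the Laurent polynomial ring. -/
noncomputable def xyProd (α : Fin n → ℤ) : A d q :=
  Finset.univ.noncommProd (fun i => xy d q i (α i)) (pairwise_commute_xy d q α _)

theorem xyProd_zero : xyProd d q 0 = 1 := by
  rw [xyProd, Finset.noncommProd_eq_pow_card _ _ _ 1, one_pow]
  intro i _
  exact xy_zero d q i

/-- Isolates the factor at `i`: the remaining product `r` does not depend on `k`, so changing one
exponent becomes a computation in one index. -/
theorem xyProd_update (α : Fin n → ℤ) (i : Fin n) : ∃ r : A d q,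
    (∀ k, xyProd d q (Function.update α i k) = xy d q i k * r) ∧ ∀ k, Commute (xy d q i k) r := by
  classical
  refine ⟨(Finset.univ.erase i).noncommProd (fun j => xy d q j (α j))
    (pairwise_commute_xy d q α _), fun k => ?_, fun k => ?_⟩
  · rw [xyProd, ← Finset.mul_noncommProd_erase _ (Finset.mem_univ i), Function.update_self]
    congr 1
    refine Finset.noncommProd_congr rfl (fun j hj => ?_) _
    rw [Function.update_of_ne (Finset.ne_of_mem_erase hj)]
  · refine Finset.noncommProd_commute _ _ _ _ fun j hj => ?_
    exact commute_xy d q (Finset.ne_of_mem_erase hj).symm _ _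

theorem add_single_eq_update (α : Fin n → ℤ) (i : Fin n) (k : ℤ) :
    α + Pi.single i k = Function.update α i (α i + k) := by
  ext j
  rcases eq_or_ne j i with rfl | hj
  · simp
  · simp [hj]

theorem xyProd_single (i : Fin n) (k : ℤ) : xyProd d q (Pi.single i k) = xy d q i k := by
  obtain ⟨r, hr, -⟩ := xyProd_update d q 0 i
  have h0 := hr 0
  rw [xy_zero, one_mul, show Function.update (0 : Fin n → ℤ) i 0 = 0 from
    Function.update_eq_self i 0, xyProd_zero] at h0
  have := hr k
  rwa [← h0, mul_one] at this

theorem x_mul_xyProd (i : Fin n) (α : Fin n → ℤ) :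
    ∃ g, x d q i * xyProd d q α = ofLaurent d q g * xyProd d q (α + Pi.single i 1) := by
  obtain ⟨r, hr, -⟩ := xyProd_update d q α i
  obtain ⟨g, hg⟩ := x_mul_xy d q i (α i)
  have h0 := hr (α i)
  rw [Function.update_eq_self] at h0
  exact ⟨g, by rw [add_single_eq_update, hr, h0, ← mul_assoc, hg, mul_assoc]⟩

theorem y_mul_xyProd (i : Fin n) (α : Fin n → ℤ) :
    ∃ g, y d q i * xyProd d q α = ofLaurent d q g * xyProd d q (α + Pi.single i (-1)) := by
  obtain ⟨r, hr, -⟩ := xyProd_update d q α i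
  obtain ⟨g, hg⟩ := y_mul_xy d q i (α i)
  have h0 := hr (α i)
  rw [Function.update_eq_self] at h0
  exact ⟨g, by rw [add_single_eq_update, hr, h0, ← mul_assoc, hg, mul_assoc, sub_eq_add_neg]⟩

theorem xyProd_of_pos {i : Fin n} {α : Fin n → ℤ} (hα : 0 < α i) :
    xyProd d q α = x d q i * xyProd d q (α + Pi.single i (-1)) ∧
      xyProd d q α = xyProd d q (α + Pi.single i (-1)) * x d q i := by
  obtain ⟨r, hr, hc⟩ := xyProd_update d q α i
  have h0 := hr (α i)
  rw [Function.update_eq_self, xy_of_pos d q i hα] at h0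
  have hx := hc 1
  rw [xy_one] at hx
  rw [add_single_eq_update, hr, h0, ← sub_eq_add_neg]
  refine ⟨mul_assoc _ _ _, ?_⟩
  rw [mul_assoc _ r, ← hx.eq, ((commute_xy_self d q i).1 (by omega)).eq, mul_assoc]

theorem xyProd_of_neg {i : Fin n} {α : Fin n → ℤ} (hα : α i < 0) :
    xyProd d q α = y d q i * xyProd d q (α + Pi.single i 1) ∧
      xyProd d q α = xyProd d q (α + Pi.single i 1) * y d q i := by
  obtain ⟨r, hr, hc⟩ := xyProd_update d q α i
  have h0 := hr (α i)
  rw [Function.update_eq_self, xy_of_neg d q i hα] at h0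
  have hy := hc (-1)
  rw [xy_neg_one] at hy
  rw [add_single_eq_update, hr, h0]
  refine ⟨mul_assoc _ _ _, ?_⟩
  rw [mul_assoc _ r, ← hy.eq, ((commute_xy_self d q i).2 (by omega)).eq, mul_assoc]

theorem xyProd_mul_ofLaurent (α : Fin n → ℤ) (f : Laurent 𝕜 n) :
    xyProd d q α * ofLaurent d q f = ofLaurent d q (shift q α f) * xyProd d q α := by
  have hx : ∀ (i : Fin n) (k : ℕ) (f : Laurent 𝕜 n), x d q i ^ k * ofLaurent d q f =
      ofLaurent d q (shift q (Pi.single i (k : ℤ)) f) * x d q i ^ k := by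
    intro i k
    induction k with
    | zero => intro f; simp [shift_zero]
    | succ k ih =>
      intro f
      rw [pow_succ, mul_assoc, x_mul_ofLaurent, ← mul_assoc, ih, ← shift_add, ← Pi.single_add,
        mul_assoc, Nat.cast_succ]
  have hy : ∀ (i : Fin n) (k : ℕ) (f : Laurent 𝕜 n), y d q i ^ k * ofLaurent d q f =
      ofLaurent d q (shift q (Pi.single i (-(k : ℤ))) f) * y d q i ^ k := by
    intro i k
    induction k with
    | zero => intro f; simp [shift_zero]
    | succ k ih =>
      intro f
      rw [pow_succ, mul_assoc, y_mul_ofLaurent, ← mul_assoc, ih, ← shift_add, ← Pi.single_add,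
        mul_assoc, Nat.cast_succ, neg_add]
  have hxy : ∀ (i : Fin n) (k : ℤ) (f : Laurent 𝕜 n), xy d q i k * ofLaurent d q f =
      ofLaurent d q (shift q (Pi.single i k) f) * xy d q i k := by
    rintro i (k | k) f
    · exact hx i k f
    · exact hy i (k + 1) f
  classical
  have key : ∀ (s : Finset (Fin n)) (hs) (f : Laurent 𝕜 n),
      s.noncommProd (fun i => xy d q i (α i)) hs * ofLaurent d q f =
        ofLaurent d q (shift q (∑ i ∈ s, Pi.single i (α i)) f) *
          s.noncommProd (fun i => xy d q i (α i)) hs := by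
    intro s
    induction s using Finset.induction_on with
    | empty => intro _ f; simp [shift_zero]
    | insert i s hi ih =>
      intro hs f
      rw [Finset.noncommProd_insert_of_notMem _ _ _ _ hi, mul_assoc, ih, ← mul_assoc, hxy,
        ← shift_add, Finset.sum_insert hi, mul_assoc]
  have := key Finset.univ (pairwise_commute_xy d q α _) f
  rwa [Finset.univ_sum_single] at this

/-- The additive span of these terms contains `1` and is stable under left multiplication by every
generator. -/
theorem exists_finsupp_sum (a : A d q) : ∃ c : (Fin n → ℤ) →₀ Laurent 𝕜 n,
    a = c.sum fun α f => ofLaurent d q f * xyProd d q α := by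
  classical
  set S : AddSubmonoid (A d q) :=
    AddSubmonoid.closure {a | ∃ f α, a = ofLaurent d q f * xyProd d q α} with hS
  have hmem : ∀ f α, ofLaurent d q f * xyProd d q α ∈ S :=
    fun f α => AddSubmonoid.subset_closure ⟨f, α, rfl⟩
  have hmul : ∀ b : A d q, (∀ f α, b * (ofLaurent d q f * xyProd d q α) ∈ S) →
      ∀ s ∈ S, b * s ∈ S := by
    intro b hb s hs
    induction hs using AddSubmonoid.closure_induction with
    | mem s hs => obtain ⟨f, α, rfl⟩ := hs; exact hb f α
    | zero => rw [mul_zero]; exact S.zero_mem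
    | add s t _ _ h1 h2 => rw [mul_add]; exact S.add_mem h1 h2
  have hmulL : ∀ g : Laurent 𝕜 n, ∀ s ∈ S, ofLaurent d q g * s ∈ S := by
    refine fun g => hmul _ fun f α => ?_
    rw [← mul_assoc, ← map_mul]
    exact hmem _ _
  have hall : ∀ b : A d q, ∀ s ∈ S, b * s ∈ S := by
    intro b
    refine gen_induction d q (P := fun b => ∀ s ∈ S, b * s ∈ S) b ?_ ?_ ?_ ?_
    · intro c
      rw [← (ofLaurent d q).commutes c]
      exact hmulL _
    · intro a b ha hb s hs
      rw [add_mul]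
      exact S.add_mem (ha s hs) (hb s hs)
    · intro a b ha hb s hs
      rw [mul_assoc]
      exact ha _ (hb _ hs)
    · rintro (i | i | i | i)
      · have := hmulL (hL 𝕜 i : Laurent 𝕜 n)
        rwa [ofLaurent_hL] at this
      · have h1 : gen d q (Gen.hinv i) = ofLaurent d q ((hL 𝕜 i)⁻¹ : (Laurent 𝕜 n)ˣ) := by
          have h2 : (h d q i : A d q) * ofLaurent d q ((hL 𝕜 i)⁻¹ : (Laurent 𝕜 n)ˣ) = 1 := by
            rw [← ofLaurent_hL, ← map_mul, Units.mul_inv, map_one]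
          exact Units.inv_eq_of_mul_eq_one_right h2
        rw [h1]
        exact hmulL _
      · refine hmul _ fun f α => ?_
        obtain ⟨g, hg⟩ := x_mul_xyProd d q i α
        change x d q i * _ ∈ S
        rw [← mul_assoc, x_mul_ofLaurent, mul_assoc, hg, ← mul_assoc, ← map_mul]
        exact hmem _ _
      · refine hmul _ fun f α => ?_
        obtain ⟨g, hg⟩ := y_mul_xyProd d q i α
        change y d q i * _ ∈ S
        rw [← mul_assoc, y_mul_ofLaurent, mul_assoc, hg, ← mul_assoc, ← map_mul]
        exact hmem _ _
  have h1 : (1 : A d q) ∈ S := by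
    have := hmem 1 0
    rwa [map_one, one_mul, xyProd_zero] at this
  have ha := hall a 1 h1
  rw [mul_one] at ha
  induction ha using AddSubmonoid.closure_induction with
  | mem s hs =>
    obtain ⟨f, α, rfl⟩ := hs
    exact ⟨Finsupp.single α f, by rw [Finsupp.sum_single_index]; simp⟩
  | zero => exact ⟨0, by simp⟩
  | add s t _ _ h1 h2 =>
    obtain ⟨c, rfl⟩ := h1
    obtain ⟨c', rfl⟩ := h2
    refine ⟨c + c', ?_⟩
    rw [Finsupp.sum_add_index'] <;> simp [add_mul]

/-! ### Images of the spanning products and the normal form -/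

theorem toSkew_mul_homogeneous {a b : A d q} {α β : Fin n → ℤ}
    (ha : ∃ p ≠ 0, toSkew d q a = skew q p α) (hb : ∃ p ≠ 0, toSkew d q b = skew q p β) :
    ∃ p ≠ 0, toSkew d q (a * b) = skew q p (α + β) := by
  obtain ⟨p, hp, hap⟩ := ha
  obtain ⟨p', hp', hbp⟩ := hb
  exact ⟨_, mul_ne_zero hp (shift_ne_zero q α hp'), by rw [map_mul, hap, hbp, skew_mul]⟩

theorem toSkew_one_homogeneous : ∃ p ≠ 0, toSkew d q 1 = skew q p 0 :=
  ⟨1, one_ne_zero, by rw [map_one, skew_one]⟩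

variable {d} in
theorem smul_hL_pow_sub_one_ne_zero (hd : 0 < d) (c : 𝕜) (i : Fin n) :
    (c • (hL 𝕜 i : Laurent 𝕜 n)) ^ d - 1 ≠ 0 := by
  intro h0
  rw [sub_eq_zero, smul_pow] at h0
  have h1 := (eq_zero_of_smul_mono_eq_one (c := c ^ d)
    (m := (d • Pi.single i 1 : Fin n → ℤ)) (by rw [← mono_pow]; exact h0)).1
  have h2 := congrFun h1 i
  simp at h2
  omega

variable {d} in
theorem toSkew_xyProd (hd : 0 < d) (α : Fin n → ℤ) :
    ∃ p ≠ 0, toSkew d q (xyProd d q α) = skew q p α := by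
  have hx : ∀ (i : Fin n) (k : ℕ), ∃ p ≠ 0, toSkew d q (x d q i ^ k) =
      skew q p (Pi.single i (k : ℤ)) := by
    intro i k
    induction k with
    | zero => simpa using toSkew_one_homogeneous d q
    | succ k ih =>
      rw [pow_succ, Nat.cast_succ, Pi.single_add]
      exact toSkew_mul_homogeneous d q ih
        ⟨_, smul_hL_pow_sub_one_ne_zero hd _ i, toSkew_x d q i⟩
  have hy : ∀ (i : Fin n) (k : ℕ), ∃ p ≠ 0, toSkew d q (y d q i ^ k) =
      skew q p (Pi.single i (-(k : ℤ))) := by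
    intro i k
    induction k with
    | zero => simpa using toSkew_one_homogeneous d q
    | succ k ih =>
      rw [pow_succ, Nat.cast_succ, neg_add, Pi.single_add]
      exact toSkew_mul_homogeneous d q ih ⟨_, one_ne_zero, toSkew_y d q i⟩
  have hxy : ∀ (i : Fin n) (k : ℤ), ∃ p ≠ 0, toSkew d q (xy d q i k) =
      skew q p (Pi.single i k) := by
    rintro i (k | k)
    · exact hx i k
    · exact hy i (k + 1)
  classical
  have key : ∀ (s : Finset (Fin n)) (hs),
      ∃ p ≠ 0, toSkew d q (s.noncommProd (fun i => xy d q i (α i)) hs) =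
        skew q p (∑ i ∈ s, Pi.single i (α i)) := by
    intro s
    induction s using Finset.induction_on with
    | empty => intro _; simpa using toSkew_one_homogeneous d q
    | insert i s hi ih =>
      intro hs
      rw [Finset.noncommProd_insert_of_notMem _ _ _ _ hi, Finset.sum_insert hi]
      exact toSkew_mul_homogeneous d q (hxy i _) (ih _)
  have := key Finset.univ (pairwise_commute_xy d q α _)
  rwa [Finset.univ_sum_single] at this

theorem skewEnd_eq_zero {f : Laurent 𝕜 n} {α : Fin n → ℤ} : skewEnd q f α = 0 ↔ f = 0 := by
  have h0 : skewEnd q 0 α = 0 := by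
    refine LinearMap.ext fun u => ?_
    simp [skewEnd_apply]
  refine ⟨fun h1 => skewEnd_injective q α (h1.trans h0.symm), ?_⟩
  rintro rfl
  exact h0

variable {d} in
/-- Normal form: `a = ∑ c_α v_α`, and `c_α` is read off from the degree `α` part of the image. -/
theorem exists_normal_form (hd : 0 < d) : ∃ p : (Fin n → ℤ) → Laurent 𝕜 n, (∀ α, p α ≠ 0) ∧
    ∀ a : A d q, ∃ c : (Fin n → ℤ) →₀ Laurent 𝕜 n,
      (a = c.sum fun α f => ofLaurent d q f * xyProd d q α) ∧
      ∀ α, (toSkew d q a).coeff α = skewEnd q (c α * p α) α := by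
  choose p hp hpv using toSkew_xyProd q hd
  refine ⟨p, hp, fun a => ?_⟩
  obtain ⟨c, hc⟩ := exists_finsupp_sum d q a
  refine ⟨c, hc, fun α => ?_⟩
  have h1 : ∀ β (f : Laurent 𝕜 n), toSkew d q (ofLaurent d q f * xyProd d q β) =
      AddMonoidAlgebra.single β (skewEnd q (f * p β) β) := by
    intro β f
    rw [map_mul, toSkew_ofLaurent, hpv, skew_mul, shift_zero, zero_add, skew]
  rw [hc, Finsupp.sum, map_sum, AddMonoidAlgebra.coeff_sum, Finsupp.finsetSum_apply]
  simp only [h1, AddMonoidAlgebra.coeff_single]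
  rw [Finset.sum_eq_single α]
  · rw [Finsupp.single_eq_same]
  · intro β _ hβ
    rw [Finsupp.single_eq_of_ne hβ.symm]
  · intro hα
    rw [Finsupp.notMem_support_iff.mp hα, zero_mul,
      (skewEnd_eq_zero q).mpr rfl, Finsupp.single_zero, Finsupp.zero_apply]

-- Outside degree `α` the normal form has `c β * p β = 0` with `p β ≠ 0`, so only the coefficient at
-- `α` survives.
variable {d} in
theorem eq_ofLaurent_mul_xyProd (hd : 0 < d) {a : A d q} {α : Fin n → ℤ}
    {T : Module.End 𝕜 (Laurent 𝕜 n)} (ha : toSkew d q a = AddMonoidAlgebra.single α T) :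
    ∃ f, a = ofLaurent d q f * xyProd d q α := by
  obtain ⟨p, hp, hnf⟩ := exists_normal_form q hd
  obtain ⟨c, hac, hc⟩ := hnf a
  have : c = Finsupp.single α (c α) := by
    ext1 β
    rcases eq_or_ne β α with rfl | hβ
    · rw [Finsupp.single_eq_same]
    · have h1 := hc β
      rw [ha, AddMonoidAlgebra.coeff_single, Finsupp.single_eq_of_ne hβ, eq_comm,
        skewEnd_eq_zero] at h1
      rw [Finsupp.single_eq_of_ne hβ]
      exact (mul_eq_zero.mp h1).resolve_right (hp β)
  refine ⟨c α, ?_⟩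
  rw [this, Finsupp.sum_single_index] at hac
  · exact hac
  · simp

/-! ### Factorisations of Laurent polynomials, and the units -/

variable {d} in
theorem mul_mem_ofLaurent (hd : 0 < d) (f g : Laurent 𝕜 n) {α β : Fin n → ℤ} (hαβ : α + β = 0) :
    ∃ l, (ofLaurent d q f * xyProd d q α) * (ofLaurent d q g * xyProd d q β) = ofLaurent d q l := by
  obtain ⟨p, -, hp⟩ := toSkew_xyProd q hd α
  obtain ⟨p', -, hp'⟩ := toSkew_xyProd q hd β
  obtain ⟨l, hl⟩ := eq_ofLaurent_mul_xyProd q hd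
    (a := (ofLaurent d q f * xyProd d q α) * (ofLaurent d q g * xyProd d q β)) (α := 0) (by
      simp only [map_mul, toSkew_ofLaurent, hp, hp', skew_mul, zero_add, hαβ]
      rfl)
  exact ⟨l, by rw [hl, xyProd_zero, mul_one]⟩

variable {d} in
/-- Both factors of a nonzero Laurent polynomial are homogeneous, of opposite degrees. -/
theorem homogeneous_of_mul (hd : 0 < d) {a b : A d q} {l : Laurent 𝕜 n} (hl : l ≠ 0)
    (hab : a * b = ofLaurent d q l) : ∃ α f g,
      a = ofLaurent d q f * xyProd d q α ∧ b = ofLaurent d q g * xyProd d q (-α) := by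
  obtain ⟨p, hp, hnf⟩ := exists_normal_form q hd
  obtain ⟨c, -, hc⟩ := hnf a
  obtain ⟨c', -, hc'⟩ := hnf b
  have hprod : toSkew d q a * toSkew d q b = AddMonoidAlgebra.single 0 (skewEnd q l 0) := by
    rw [← map_mul, hab, toSkew_ofLaurent, skew]
  have hne : toSkew d q a * toSkew d q b ≠ 0 := by
    rw [hprod, Ne, AddMonoidAlgebra.single_eq_zero, skewEnd_eq_zero]
    exact hl
  -- The operator ring may have zero divisors, but the coefficients here are of the form `f σ^α`,
  -- and products of nonzero ones are nonzero since the Laurent ring is a domain.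
  obtain ⟨α, β, hαβ, h1, h2⟩ := eq_single_of_mul_eq_single hprod (fun α β h1 h2 => by
    rw [hc, hc', Ne, skewEnd_eq_zero] at *
    rw [skewEnd_mul, skewEnd_eq_zero]
    exact mul_ne_zero h1 (shift_ne_zero q α h2)) (left_ne_zero_of_mul hne)
    (right_ne_zero_of_mul hne)
  obtain ⟨f, hf⟩ := eq_ofLaurent_mul_xyProd q hd h1
  obtain ⟨g, hg⟩ := eq_ofLaurent_mul_xyProd q hd h2
  obtain rfl : β = -α := (neg_eq_of_add_eq_zero_right hαβ).symm
  exact ⟨α, f, g, hf, hg⟩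

-- A `y_j` splits off on the left and an `x_j` on the right. What lies between has degree zero,
-- hence is a Laurent polynomial, and moving `y_j` past it leaves the factor `y_j x_j`.
variable {d} in
theorem mul_of_pos (hd : 0 < d) {α : Fin n → ℤ} {j : Fin n} (hα : 0 < α j) (f g : Laurent 𝕜 n) :
    ∃ l, (ofLaurent d q g * xyProd d q (-α)) * (ofLaurent d q f * xyProd d q α) =
      ofLaurent d q (l * ((hL 𝕜 j : Laurent 𝕜 n) ^ d - 1)) := by
  obtain ⟨l, hl⟩ := mul_mem_ofLaurent q hd (shift q (Pi.single j 1) g) f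
    (α := -α + Pi.single j 1) (β := α + Pi.single j (-1)) (by rw [Pi.single_neg]; abel)
  have h1 : y d q j * ofLaurent d q (shift q (Pi.single j 1) g) = ofLaurent d q g * y d q j := by
    rw [y_mul_ofLaurent, Pi.single_neg, shift_neg_shift]
  refine ⟨shift q (Pi.single j (-1)) l, ?_⟩
  rw [(xyProd_of_neg d q (α := -α) (i := j) (by simpa using hα)).1,
    ← mul_assoc (ofLaurent d q g), ← h1, (xyProd_of_pos d q hα).2, map_mul, ← y_mul_x,
    ← mul_assoc (ofLaurent d q _) (y d q j),
    ← y_mul_ofLaurent, ← hl]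
  simp only [mul_assoc]

variable {d} in
theorem mul_of_neg (hd : 0 < d) {α : Fin n → ℤ} {j : Fin n} (hα : α j < 0) (f g : Laurent 𝕜 n) :
    ∃ l, (ofLaurent d q g * xyProd d q (-α)) * (ofLaurent d q f * xyProd d q α) =
      ofLaurent d q (l * (((q j : 𝕜) • (hL 𝕜 j : Laurent 𝕜 n)) ^ d - 1)) := by
  obtain ⟨l, hl⟩ := mul_mem_ofLaurent q hd (shift q (Pi.single j (-1)) g) f
    (α := -α + Pi.single j (-1)) (β := α + Pi.single j 1) (by rw [Pi.single_neg]; abel)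
  have h1 : x d q j * ofLaurent d q (shift q (Pi.single j (-1)) g) =
      ofLaurent d q g * x d q j := by
    rw [x_mul_ofLaurent, Pi.single_neg, shift_shift_neg]
  refine ⟨shift q (Pi.single j 1) l, ?_⟩
  rw [(xyProd_of_pos d q (α := -α) (i := j) (by simpa using hα)).1,
    ← mul_assoc (ofLaurent d q g), ← h1, (xyProd_of_neg d q hα).2, map_mul, ← x_mul_y,
    ← mul_assoc (ofLaurent d q _) (x d q j),
    ← x_mul_ofLaurent, ← hl]
  simp only [mul_assoc, Pi.single_neg]

theorem evalAt_smul_hL_pow_sub_one (c : 𝕜ˣ) (j : Fin n) :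
    evalAt c⁻¹ j (((c : 𝕜) • (hL 𝕜 j : Laurent 𝕜 n)) ^ d - 1) = 0 := by
  rw [map_sub, map_one, map_pow, map_smul, evalAt_hL_self, Algebra.algebraMap_eq_smul_one,
    smul_smul]
  simp

theorem evalAt_one_hL_pow_sub_one (j : Fin n) :
    evalAt 1 j ((hL 𝕜 j : Laurent 𝕜 n) ^ d - 1) = 0 := by
  have := evalAt_smul_hL_pow_sub_one d (1 : 𝕜ˣ) j
  rwa [inv_one, Units.val_one, one_smul] at this

variable {d} in
/-- The units of `A(n, d, q)` are the monomials `c h^m`. -/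
theorem unit_eq_smul_mono (hd : 0 < d) (u : (A d q)ˣ) :
    ∃ (c : 𝕜ˣ) (m : Fin n → ℤ), (u : A d q) = ofLaurent d q ((c : 𝕜) • mono 𝕜 m) := by
  obtain ⟨α, f, g, hf, hg⟩ := homogeneous_of_mul q hd one_ne_zero
    (u.mul_inv.trans (map_one (ofLaurent d q)).symm)
  have hgf : (ofLaurent d q g * xyProd d q (-α)) * (ofLaurent d q f * xyProd d q α) =
      ofLaurent d q 1 := by rw [← hf, ← hg, u.inv_mul, map_one]
  -- A nonzero `α j` would make `1` divisible by a polynomial vanishing at `h_j = 1` or at `h_j =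
  -- q_j⁻¹`.
  have hα : α = 0 := by
    ext1 j
    by_contra hj
    rcases lt_or_gt_of_ne hj with hj | hj
    · obtain ⟨l, hl⟩ := mul_of_neg q hd hj f g
      have := congrArg (evalAt (q j)⁻¹ j) (ofLaurent_injective d q (hgf.symm.trans hl))
      rw [map_mul, evalAt_smul_hL_pow_sub_one, mul_zero, map_one] at this
      exact one_ne_zero this
    · obtain ⟨l, hl⟩ := mul_of_pos q hd hj f g
      have := congrArg (evalAt 1 j) (ofLaurent_injective d q (hgf.symm.trans hl))
      rw [map_mul, evalAt_one_hL_pow_sub_one, mul_zero, map_one] at this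
      exact one_ne_zero this
  subst hα
  rw [neg_zero, xyProd_zero, mul_one, mul_one, ← map_mul] at hgf
  have h1 : f * g = 1 := by rw [mul_comm]; exact ofLaurent_injective d q hgf
  obtain ⟨c, m, rfl⟩ := laurent_unit h1
  exact ⟨c, m, by rw [hf, xyProd_zero, mul_one]⟩

end Basis

end QWA

namespace QWA

/-! ### Images of the generators under an endomorphism -/

section Endomorphism

variable {𝕜 : Type*} [Field 𝕜] {n : ℕ} {d : ℕ}

theorem ofLaurent_mul_right_cancel (q : Fin n → 𝕜ˣ) {b : A d q} {α : Fin n → ℤ}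
    (hb : ∃ p ≠ 0, toSkew d q b = skew q p α) {f g : Laurent 𝕜 n}
    (hfg : ofLaurent d q f * b = ofLaurent d q g * b) : f = g := by
  obtain ⟨p, hp, hbp⟩ := hb
  have h1 := congrArg (toSkew d q) hfg
  rw [map_mul, map_mul, hbp, toSkew_ofLaurent, toSkew_ofLaurent, skew_mul, skew_mul, skew_inj,
    shift_zero] at h1
  exact mul_right_cancel₀ hp h1

theorem ofLaurent_hL_inv (q : Fin n → 𝕜ˣ) (i : Fin n) :
    ofLaurent d q ((hL 𝕜 i)⁻¹ : (Laurent 𝕜 n)ˣ) = ((h d q i)⁻¹ : (A d q)ˣ) := by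
  refine (Units.inv_eq_of_mul_eq_one_right ?_).symm
  rw [← ofLaurent_hL, ← map_mul, Units.mul_inv, map_one]

theorem smul_mono_ne_zero (c : 𝕜ˣ) (m : Fin n → ℤ) : (c : 𝕜) • mono 𝕜 m ≠ 0 := by
  rw [mono, AddMonoidAlgebra.smul_single, Ne, AddMonoidAlgebra.single_eq_zero]
  simp

theorem eq_zero_of_zpow_eq_one {q : 𝕜ˣ} (hq : ∀ m : ℕ, 0 < m → q ^ m ≠ 1) {k : ℤ}
    (hk : q ^ k = 1) : k = 0 := by
  rcases lt_trichotomy k 0 with h | h | h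
  · refine absurd ?_ (hq (-k).toNat (by omega))
    rw [← zpow_natCast, Int.toNat_of_nonneg (by omega), zpow_neg, hk, inv_one]
  · exact h
  · refine absurd ?_ (hq k.toNat (by omega))
    rw [← zpow_natCast, Int.toNat_of_nonneg (by omega), hk]

/-- If `X = f v_α` and `X u = c u X` for a monomial unit `u = γ h^m`, then `c` is the pairing of
`α` and `m`. -/
theorem chi_eq_of_mul_eq_smul (q : Fin n → 𝕜ˣ) (hd : 0 < d) {f : Laurent 𝕜 n} (hf : f ≠ 0)
    {α m : Fin n → ℤ} {γ c : 𝕜ˣ}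
    (hX : ofLaurent d q f * xyProd d q α * ofLaurent d q ((γ : 𝕜) • mono 𝕜 m) =
      (c : 𝕜) • (ofLaurent d q ((γ : 𝕜) • mono 𝕜 m) * (ofLaurent d q f * xyProd d q α))) :
    chi q α m = c := by
  rw [mul_assoc, xyProd_mul_ofLaurent, ← mul_assoc, ← mul_assoc, ← map_mul, ← map_mul,
    ← smul_mul_assoc, ← map_smul] at hX
  have h1 := ofLaurent_mul_right_cancel q (toSkew_xyProd q hd α) hX
  rw [map_smul, shift_mono, smul_comm, mul_smul_comm, mul_comm f] at h1
  exact Units.ext (smul_left_injective 𝕜 (mul_ne_zero (smul_mono_ne_zero γ m) hf) h1)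

/-- Since `v = u⁻¹`, `v - 1 = -u⁻¹ (u - 1)`, and `u - 1` cancels. It serves the case `τ = 1`, where
`u = (q h_j)^d` and `v = H^d`. -/
theorem mul_eq_neg_one_of_mul_sub_one {R : Type*} [CommRing R] [IsDomain R] {g u v : R}
    (h : g * (u - 1) = v - 1) (hvu : v * u = 1) (hu : u - 1 ≠ 0) : g * u = -1 := by
  refine mul_right_cancel₀ hu ?_
  linear_combination u * h + hvu

/-- Treats one index in isolation, for `X, Y, H` the images of `x_i, y_i, h_i`; the exponent `1 -
2τ` is the common value `α_j = m_j = ±1`. -/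
theorem exists_standard_form {q : 𝕜ˣ} (hd : 0 < d) (hq : ∀ m : ℕ, 0 < m → q ^ m ≠ 1)
    {X Y H : A d (fun _ : Fin n => q)} (hHu : IsUnit H) (hXH : X * H = (q : 𝕜) • (H * X))
    (hXY : X * Y = ((q : 𝕜) • H) ^ d - 1) (hYX : Y * X = H ^ d - 1) :
    ∃ (j : Fin n) (τ : Fin 2) (γ : 𝕜ˣ) (e e' : (Laurent 𝕜 n)ˣ),
      H = ofLaurent d (fun _ => q) ((γ : 𝕜) • mono 𝕜 (Pi.single j (1 - 2 * ((τ : ℕ) : ℤ)))) ∧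
      X = ofLaurent d (fun _ => q) e *
        xyProd d (fun _ => q) (Pi.single j (1 - 2 * ((τ : ℕ) : ℤ))) ∧
      Y = xyProd d (fun _ => q) (-Pi.single j (1 - 2 * ((τ : ℕ) : ℤ))) *
        ofLaurent d (fun _ => q) e' ∧
      γ ^ d = q ^ (-((τ : ℕ) * d : ℤ)) ∧
      e * e' = (-1) ^ (τ : ℕ) * hL 𝕜 j ^ (-(d * (τ : ℕ) : ℤ)) := by
  obtain ⟨c, m, hH⟩ := unit_eq_smul_mono (fun _ : Fin n => q) hd hHu.unit
  rw [IsUnit.unit_spec] at hH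
  have hqd : (q : 𝕜) ^ d - 1 ≠ 0 := by
    rw [sub_ne_zero]
    intro h0
    exact hq d hd (Units.ext (by simpa using h0))
  have hYX' : Y * X = ofLaurent d (fun _ => q) (((c : 𝕜) • mono 𝕜 m) ^ d - 1) := by
    rw [hYX, hH, map_sub, map_pow, map_one]
  -- If `H^d = 1`, then `Y X = 0` while `X Y` is the nonzero scalar `q^d - 1`; then `X Y X = 0`
  -- forces `X = 0`, a contradiction.
  have hl : ((c : 𝕜) • mono 𝕜 m) ^ d - 1 ≠ 0 := by
    intro h0
    rw [h0, map_zero] at hYX'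
    have hHd : H ^ d = 1 := sub_eq_zero.mp (hYX.symm.trans hYX')
    have h1 : X * Y = ofLaurent d (fun _ : Fin n => q) (((q : 𝕜) ^ d - 1) • 1) := by
      rw [hXY, smul_pow, hHd, sub_smul, one_smul, map_sub, map_smul, map_one]
    have h2 : ((q : 𝕜) ^ d - 1) • X = 0 := by
      rw [← one_mul X, ← smul_mul_assoc, ← map_one (ofLaurent d (fun _ : Fin n => q)),
        ← map_smul, ← h1, mul_assoc, hYX', mul_zero]
    rw [(smul_eq_zero.mp h2).resolve_left hqd, zero_mul,
      ← map_zero (ofLaurent d (fun _ : Fin n => q))] at h1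
    exact smul_ne_zero hqd one_ne_zero (ofLaurent_injective d _ h1).symm
  obtain ⟨β, g, f, hY, hX⟩ := homogeneous_of_mul (fun _ : Fin n => q) hd hl hYX'
  obtain ⟨α, rfl⟩ : ∃ α, β = -α := ⟨-β, (neg_neg β).symm⟩
  rw [neg_neg] at hX
  have hf : f ≠ 0 := by
    rintro rfl
    rw [map_zero, zero_mul] at hX
    rw [hX, mul_zero, ← map_zero (ofLaurent d fun _ : Fin n => q)] at hYX'
    exact hl (ofLaurent_injective d _ hYX').symm
  have hchi : chi (fun _ => q) α m = q := by
    rw [hX, hH] at hXH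
    exact chi_eq_of_mul_eq_smul (fun _ : Fin n => q) hd hf hXH
  -- The factor attached to `j` divides `Y X = H^d - 1`; evaluating at its root (`1` or `q⁻¹`)
  -- constrains both `m` and `c`.
  have hsupp : ∀ j, α j ≠ 0 → m = Pi.single j (m j) ∧
      (0 < α j → c ^ d = 1) ∧ (α j < 0 → (c * q⁻¹ ^ m j) ^ d = 1) := by
    intro j hj
    rcases lt_or_gt_of_ne hj with hj | hj
    · obtain ⟨l, hl⟩ := mul_of_neg (fun _ : Fin n => q) hd hj f g
      rw [← hX, ← hY, hYX'] at hl
      obtain ⟨h1, h2⟩ := exponent_of_dvd hd (ofLaurent_injective d _ hl)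
        (evalAt_smul_hL_pow_sub_one d q j)
      exact ⟨h1, fun h3 => absurd h3 hj.not_gt, fun _ => h2⟩
    · obtain ⟨l, hl⟩ := mul_of_pos (fun _ : Fin n => q) hd hj f g
      rw [← hX, ← hY, hYX'] at hl
      obtain ⟨h1, h2⟩ := exponent_of_dvd hd (ofLaurent_injective d _ hl)
        (evalAt_one_hL_pow_sub_one d j)
      rw [one_zpow, mul_one] at h2
      exact ⟨h1, fun _ => h2, fun h3 => absurd h3 hj.not_gt⟩
  have hα : ∃ j, α j ≠ 0 := by
    by_contra! h0
    have h1 : chi (fun _ => q) α m = 1 := by simp [chi, h0]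
    rw [hchi] at h1
    exact hq 1 one_pos (by rw [pow_one, h1])
  obtain ⟨j, hj⟩ := hα
  obtain ⟨hm, hpos, hneg⟩ := hsupp j hj
  have hαm : α j * m j = 1 := by
    have h1 : chi (fun _ => q) α m = q ^ (α j * m j) := by
      rw [chi, Finset.prod_eq_single j]
      · intro i _ hij
        rw [hm, Pi.single_eq_of_ne hij, mul_zero, zpow_zero]
      · simp
    rw [hchi] at h1
    have h2 := eq_zero_of_zpow_eq_one hq (k := α j * m j - 1) (by
      rw [zpow_sub_one, ← h1, mul_inv_cancel])
    omega
  -- A second index `i` with `α i ≠ 0` would confine `m` to `i`, so `m j = 0`, against `α j * m j =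
  -- 1`.
  have hαj : α = Pi.single j (α j) := by
    ext i
    rcases eq_or_ne i j with rfl | hij
    · rw [Pi.single_eq_same]
    · rw [Pi.single_eq_of_ne hij]
      by_contra hi
      have h1 := congrFun (hsupp i hi).1 j
      rw [Pi.single_eq_of_ne hij.symm] at h1
      rw [h1, mul_zero] at hαm
      exact zero_ne_one hαm
  rcases Int.eq_one_or_neg_one_of_mul_eq_one' hαm with ⟨ha, hm1⟩ | ⟨ha, hm1⟩
  · have hc := hpos (by omega)
    rw [ha] at hαj
    rw [hm1] at hm
    have hG : g * shift (fun _ => q) (Pi.single j (-1)) f = 1 := by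
      have h1 : ((c : 𝕜) • mono 𝕜 m) ^ d - 1 = (hL 𝕜 j : Laurent 𝕜 n) ^ d - 1 := by
        rw [smul_pow, ← Units.val_pow_eq_pow_val, hc, Units.val_one, one_smul, hm]
        rfl
      rw [h1, hY, hX, hαj, ← Pi.single_neg, xyProd_single, xyProd_single, xy_one, xy_neg_one,
        mul_assoc, ← mul_assoc (y d _ j), y_mul_ofLaurent, mul_assoc (ofLaurent d _ _), y_mul_x,
        ← map_mul, ← map_mul] at hYX'
      have h2 := ofLaurent_injective d _ hYX'
      rw [← mul_assoc] at h2
      rw [h1] at hl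
      exact mul_right_cancel₀ hl (h2.trans (one_mul _).symm)
    have hG' : f * shift (fun _ => q) (Pi.single j 1) g = 1 := by
      have := congrArg (shift (fun _ => q) (Pi.single j 1)) hG
      rwa [map_mul, map_one, Pi.single_neg, shift_shift_neg, mul_comm] at this
    -- Here `X = f x_j` and `Y = g y_j = y_j σ_j(g)`, so `e = f` and `e' = σ_j(g) = f⁻¹`.
    refine ⟨j, 0, c, Units.mk _ _ hG' (by rw [mul_comm, hG']),
      (Units.mk _ _ hG' (by rw [mul_comm, hG']))⁻¹, ?_, ?_, ?_, ?_, ?_⟩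
    · rw [hH, hm]; simp
    · rw [hX, hαj]; simp
    · simp only [Fin.coe_ofNat_eq_mod, Nat.zero_mod, Nat.cast_zero, mul_zero, sub_zero]
      rw [xyProd_mul_ofLaurent, hY, hαj]
      simp [shift_neg_shift]
    · simp [hc]
    · rw [mul_inv_cancel]; simp
  · have hc := hneg (by omega)
    rw [hm1, zpow_neg_one, inv_inv] at hc
    rw [ha] at hαj
    rw [hm1] at hm
    set u : Laurent 𝕜 n := (q : 𝕜) • (hL 𝕜 j : Laurent 𝕜 n) with hu
    have hcu : ((c : 𝕜) • mono 𝕜 m) ^ d * u ^ d = 1 := by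
      have h1 : mono 𝕜 m * (hL 𝕜 j : Laurent 𝕜 n) = 1 := by
        rw [hm]
        change mono 𝕜 _ * mono 𝕜 _ = 1
        rw [← mono_add, ← Pi.single_add, neg_add_cancel, Pi.single_zero, mono_zero]
      rw [← mul_pow, hu, smul_mul_smul_comm, h1, ← Units.val_mul, smul_pow,
        ← Units.val_pow_eq_pow_val, hc, Units.val_one, one_pow, one_smul]
    -- Now `X = f y_j` and `Y = g x_j`, so `Y X = g σ_j(f) (u^d - 1)`, to be compared with `H^d - 1
    -- = u^(-d) - 1`.
    have hG : (g * shift (fun _ => q) (Pi.single j 1) f) * u ^ d = -1 := by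
      rw [hY, hX, hαj, ← Pi.single_neg, neg_neg, xyProd_single, xyProd_single, xy_one,
        xy_neg_one, mul_assoc, ← mul_assoc (x d _ j), x_mul_ofLaurent,
        mul_assoc (ofLaurent d _ _), x_mul_y, ← map_mul, ← map_mul] at hYX'
      have h2 := ofLaurent_injective d _ hYX'
      rw [← hu, ← mul_assoc] at h2
      exact mul_eq_neg_one_of_mul_sub_one h2 hcu
        (smul_hL_pow_sub_one_ne_zero hd (q : 𝕜) j)
    -- Applying `σ_j⁻¹` turns `u` into `h_j`. As `Y = x_j σ_j⁻¹(g)`, this is the identity for `e =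
    -- f` and `e' = σ_j⁻¹(g)`.
    have hG' : f * shift (fun _ => q) (Pi.single j (-1)) g * (hL 𝕜 j : Laurent 𝕜 n) ^ d = -1 := by
      have := congrArg (shift (fun _ => q) (Pi.single j (-1))) hG
      have hsu : shift (fun _ => q) (Pi.single j (-1)) u = (hL 𝕜 j : Laurent 𝕜 n) := by
        rw [hu, map_smul, shift_single_hL_self, smul_smul, zpow_neg_one, ← Units.val_mul,
          mul_inv_cancel, Units.val_one, one_smul]
      have hsf : shift (fun _ => q) (Pi.single j (-1)) (shift (fun _ => q) (Pi.single j 1) f) =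
          f := by
        rw [Pi.single_neg, shift_neg_shift]
      rw [map_mul, map_mul, map_neg, map_one, map_pow, hsu, hsf, mul_comm _ f] at this
      exact this
    have he : f * -(shift (fun _ => q) (Pi.single j (-1)) g * (hL 𝕜 j : Laurent 𝕜 n) ^ d) = 1 := by
      rw [mul_neg, ← mul_assoc, hG', neg_neg]
    have he' : shift (fun _ => q) (Pi.single j (-1)) g * -(f * (hL 𝕜 j : Laurent 𝕜 n) ^ d) = 1 := by
      rw [mul_neg, ← mul_assoc, mul_comm _ f, hG', neg_neg]
    refine ⟨j, 1, c, Units.mk _ _ he (by rw [mul_comm, he]),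
      Units.mk _ _ he' (by rw [mul_comm, he']), ?_, ?_, ?_, ?_, ?_⟩
    · rw [hH, hm]; simp
    · rw [hX, hαj]; simp
    · simp only [Fin.coe_ofNat_eq_mod, Nat.one_mod, Nat.cast_one]
      rw [xyProd_mul_ofLaurent, hY, hαj]
      norm_num [← Pi.single_neg, ← shift_add, ← Pi.single_add, shift_zero]
    · simp only [Fin.coe_ofNat_eq_mod, Nat.one_mod, Nat.cast_one, one_mul, zpow_neg, zpow_natCast]
      rw [mul_pow] at hc
      exact eq_inv_of_mul_eq_one_left hc
    · simp only [Fin.coe_ofNat_eq_mod, Nat.one_mod, Nat.cast_one, mul_one, zpow_neg, zpow_natCast,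
        pow_one]
      rw [eq_mul_inv_iff_mul_eq]
      exact Units.ext hG'

/-- One of the two powers is always trivial; truncated subtraction is harmless because `τ ≤ 1`. -/
theorem xyProd_single_eq_pow (q : Fin n → 𝕜ˣ) (j : Fin n) (τ : Fin 2) :
    xyProd d q (Pi.single j (1 - 2 * ((τ : ℕ) : ℤ))) =
      x d q j ^ (1 - (τ : ℕ)) * y d q j ^ (τ : ℕ) := by
  rw [xyProd_single]
  fin_cases τ
  · simp [xy_one]
  · simp [← xy_neg_one]

theorem xyProd_neg_single_eq_pow (q : Fin n → 𝕜ˣ) (j : Fin n) (τ : Fin 2) :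
    xyProd d q (-Pi.single j (1 - 2 * ((τ : ℕ) : ℤ))) =
      x d q j ^ (τ : ℕ) * y d q j ^ (1 - (τ : ℕ)) := by
  rw [← Pi.single_neg, xyProd_single]
  fin_cases τ
  · simp [xy_neg_one]
  · simp [← xy_one]

theorem ofLaurent_mono_single_eq_zpow (q : Fin n → 𝕜ˣ) (j : Fin n) (τ : Fin 2) :
    ofLaurent d q (mono 𝕜 (Pi.single j (1 - 2 * ((τ : ℕ) : ℤ)))) =
      ((h d q j ^ ((-1 : ℤ) ^ (τ : ℕ)) : (A d q)ˣ) : A d q) := by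
  fin_cases τ
  · simpa [hL] using ofLaurent_hL d q j
  · simpa [hL, Pi.single_neg] using ofLaurent_hL_inv (d := d) q j

theorem σ_zpow_apply (q : Fin n → 𝕜ˣ) (j : Fin n) (τ : Fin 2) (f : Laurent 𝕜 n) :
    (σ q j ^ (1 - 2 * ((τ : ℕ) : ℤ))) f = shift q (Pi.single j (1 - 2 * ((τ : ℕ) : ℤ))) f := by
  fin_cases τ
  · simpa using σ_apply q j f
  · simpa using σ_symm_apply q j f

end Endomorphism

end QWA

/-- Endomorphisms of `A(n, d, (q, …, q))` for `q` not a root of unity. The `e i` and `e' i` are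
units of `𝕜[h_1^{±1}, …, h_n^{±1}]`, regarded as units of the algebra through `QWA.ofLaurent`. -/
theorem corollary4p1 {𝕜 : Type*} [Field 𝕜] (n d : ℕ) (hd : 0 < d) (q : 𝕜ˣ)
    (hq : ∀ m : ℕ, 0 < m → q ^ m ≠ 1)
    (ψ : QWA.A d (fun _ : Fin n => q) →ₐ[𝕜] QWA.A d (fun _ : Fin n => q)) :
    ∃ (w : Equiv.Perm (Fin n)) (τ : Fin n → Fin 2) (γ : Fin n → 𝕜ˣ)
      (e e' : Fin n → (QWA.Laurent 𝕜 n)ˣ),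
      (∀ i, ψ (QWA.h d (fun _ => q) i) =
        (γ i : 𝕜) • ((QWA.h d (fun _ => q) (w i) ^ ((-1 : ℤ) ^ (τ i : ℕ)) :
          (QWA.A d (fun _ : Fin n => q))ˣ) : QWA.A d (fun _ : Fin n => q))) ∧
      (∀ i, ψ (QWA.x d (fun _ => q) i) =
        QWA.ofLaurent d (fun _ => q) (e i) *
          (QWA.x d (fun _ => q) (w i) ^ (1 - (τ i : ℕ)) *
            QWA.y d (fun _ => q) (w i) ^ (τ i : ℕ))) ∧
      (∀ i, ψ (QWA.y d (fun _ => q) i) =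
        (QWA.x d (fun _ => q) (w i) ^ (τ i : ℕ) *
            QWA.y d (fun _ => q) (w i) ^ (1 - (τ i : ℕ))) *
          QWA.ofLaurent d (fun _ => q) (e' i)) ∧
      (∀ i, γ i ^ d = q ^ (-((τ i : ℕ) * d : ℤ))) ∧
      (∀ i, e i * e' i = (-1) ^ (τ i : ℕ) * QWA.hL 𝕜 (w i) ^ (-(d * (τ i : ℕ) : ℤ))) ∧
      (∀ i l, i ≠ l →
        (e i : QWA.Laurent 𝕜 n) *
            (QWA.σ (fun _ => q) (w i) ^ (1 - 2 * ((τ i : ℕ) : ℤ))) (e l : QWA.Laurent 𝕜 n) =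
          (e l : QWA.Laurent 𝕜 n) *
            (QWA.σ (fun _ => q) (w l) ^ (1 - 2 * ((τ l : ℕ) : ℤ))) (e i : QWA.Laurent 𝕜 n)) := by
  have hform := fun i => QWA.exists_standard_form hd hq
    (((QWA.h d (fun _ : Fin n => q) i).isUnit).map ψ)
    (by simpa only [map_mul, map_smul] using congrArg ψ (QWA.x_mul_h d (fun _ => q) i))
    (by simpa [QWA.ofLaurent_hL] using congrArg ψ (QWA.x_mul_y d (fun _ => q) i))
    (by simpa [QWA.ofLaurent_hL] using congrArg ψ (QWA.y_mul_x d (fun _ => q) i))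
  choose j τ γ e e' hH hX hY hγ he using hform
  -- If `j i = j l`, then commutation of `x_i` with `h_l` gives `q ^ ((1 - 2τ_i)(1 - 2τ_l)) = 1`,
  -- impossible because the exponent is odd.
  have hinj : Function.Injective j := by
    intro i l hil
    by_contra hne
    have h1 := congrArg ψ (QWA.commute_h_x d (fun _ => q) (Ne.symm hne)).symm.eq
    have h2 : ψ (QWA.h d (fun _ => q) l) = _ := hH l
    rw [map_mul, map_mul, hX, h2] at h1
    have h3 := QWA.chi_eq_of_mul_eq_smul (fun _ : Fin n => q) hd (γ := γ l) (c := 1)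
      (α := Pi.single (j i) (1 - 2 * ((τ i : ℕ) : ℤ)))
      (m := Pi.single (j l) (1 - 2 * ((τ l : ℕ) : ℤ))) (e i).ne_zero
      (by rw [Units.val_one, one_smul]; exact h1)
    rw [hil, QWA.chi_single_left, Pi.single_eq_same] at h3
    have h4 := QWA.eq_zero_of_zpow_eq_one hq h3
    rcases mul_eq_zero.mp h4 with h5 | h5 <;> omega
  have hmul : ∀ i l, ψ (QWA.x d (fun _ => q) i) * ψ (QWA.x d (fun _ => q) l) =
      QWA.ofLaurent d (fun _ => q) ((e i : QWA.Laurent 𝕜 n) * QWA.shift (fun _ => q)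
        (Pi.single (j i) (1 - 2 * ((τ i : ℕ) : ℤ))) (e l : QWA.Laurent 𝕜 n)) *
      (QWA.xyProd d (fun _ => q) (Pi.single (j i) (1 - 2 * ((τ i : ℕ) : ℤ))) *
        QWA.xyProd d (fun _ => q) (Pi.single (j l) (1 - 2 * ((τ l : ℕ) : ℤ)))) := by
    intro i l
    rw [hX, hX, mul_assoc, ← mul_assoc (QWA.xyProd d _ _) (QWA.ofLaurent d _ _),
      QWA.xyProd_mul_ofLaurent, map_mul, mul_assoc (QWA.ofLaurent d _ _),
      mul_assoc (QWA.ofLaurent d _ _)]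
  refine ⟨Equiv.ofBijective j (Finite.injective_iff_bijective.mp hinj), τ, γ, e, e', fun i => ?_,
    fun i => ?_, fun i => ?_, hγ, he, fun i l hil => ?_⟩
  · rw [Equiv.ofBijective_apply, ← QWA.ofLaurent_mono_single_eq_zpow, ← map_smul]
    exact hH i
  · rw [Equiv.ofBijective_apply, ← QWA.xyProd_single_eq_pow]
    exact hX i
  · rw [Equiv.ofBijective_apply, ← QWA.xyProd_neg_single_eq_pow]
    exact hY i
  · rw [Equiv.ofBijective_apply, Equiv.ofBijective_apply, QWA.σ_zpow_apply, QWA.σ_zpow_apply]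
    -- Both orders of the product carry the same `xyProd` factors, which commute since `j i ≠ j l`;
    -- cancelling them leaves the identity between the Laurent coefficients.
    have h1 := congrArg ψ (QWA.commute_x_x d (fun _ => q) hil).eq
    have hc := QWA.commute_xy d (fun _ => q) (hinj.ne hil) (1 - 2 * ((τ i : ℕ) : ℤ))
      (1 - 2 * ((τ l : ℕ) : ℤ))
    rw [← QWA.xyProd_single, ← QWA.xyProd_single] at hc
    rw [map_mul, map_mul, hmul, hmul, hc.eq] at h1
    exact QWA.ofLaurent_mul_right_cancel _ (QWA.toSkew_mul_homogeneous d _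
      (QWA.toSkew_xyProd _ hd _) (QWA.toSkew_xyProd _ hd _)) h1
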